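/- Let $g:\mathbb R^d\to\mathbb R^{d\times d}$ be a smooth field of symmetric positive definite matrices, $G(x)=g(x)^{-1}$, and $$H(x,y,p,q)=\tfrac12(g(x)q,q)-(G(x)y,p)+\tfrac12\Big(\tfrac{\partial}{\partial x}(G(x)y,y),q\Big),\qquad x,y,p,q\in\mathbb R^d .$$ For a starting point $(x_0,y_0)$ and initial momenta $(p_0,q_0)$ let $(X,Y,P,Q)(t)$ be the solution of Hamilton's equations $\dot x=\partial_pH$, $\dot y=\partial_qH$, $\dot p=-\partial_xH$, $\dot q=-\partial_yH$ with these initial values (the characteristic), and let $J=\det\frac{\partial(X,Y)}{\partial(p_0,q_0)}$. Let $x_0\in\mathbb R^d$, $T>0$ and $b,c,r\in(0,\infty]$. For $0<t<T$ let $Z_t(y_0)$ be the set of all $(p_0,q_0)$ with $t^3|p_0|<c$, $t^2|q_0|<c$ whose characteristic from $(x_0,y_0)$ exists on $[0,t]$. Assume that for all $0<t<T$ and all $y_0$ with $t|y_0|<b$ the map $(p_0,q_0)\mapsto(X,Y)(t)$ is injective on $Z_t(y_0)$ with $J\ne0$ there, and that its image contains the polydisk $\{|x-x_0|<r,\ |y-y_0|<r/t\}$.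 (For $b=c=r=\infty$ this says that the boundary value problem for Hamilton's equations is uniquely and nondegenerately solvable in the whole cotangent bundle.) Then for all real $\rho<r$ and $\beta<b$ with $\rho,\beta\ge0$ there is a constant $K$ such that the following holds for every $y_0$ with $T|y_0|\le\beta$. Let $\Omega$ be the set of all $(t,X(t),Y(t))$ with $0<t<T$ and $(p_0,q_0)\in Z_t(y_0)$ (so $\Omega=(0,T)\times\mathbb R^{2d}$ if $b=c=r=\infty$). Let $S(t,x,y)$ be the two-point function, that is, the action $\int_0^t(P\,\dot X+Q\,\dot Y-H)\,ds$ of the characteristic with momenta in $Z_t(y_0)$ from $(x_0,y_0)$ to $(x,y)$ in time $t$, and let $\phi(t,x,y)$ be real-valued; let $S$ and $\phi$ be $C^2$ on $\Omega$ and satisfy there the Hamilton–Jacobi equation $\partial_tS+H(x,y,\partial_xS,\partial_yS)=0$ and the transport equation $$\partial_t\phi+(g\,\partial_yS,\partial_y\phi)+\tfrac12\phi\,\mathrm{tr}(g\,\partial_y^2S)-(G y,\partial_x\phi)+\tfrac12\Big(\tfrac{\partial}{\partial x}(G y,y),\partial_y\phi\Big)=0 ,$$ and let $t^{2d}\phi(t,x,y)$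 converge to a constant as $(t,x,y)\to(0,x_0,y_0)$ in $\Omega$. Let $C(h)$ be any real function of $h$ and $u^0=C(h)\,\phi\,e^{-S/h}$. Then for every $h>0$ $$\Big[h\tfrac{\partial}{\partial t}-H\big(x,y,-h\tfrac{\partial}{\partial x},-h\tfrac{\partial}{\partial y}\big)\Big]u^0=-\tfrac{h^2}{2}\,C(h)\,\mathrm{tr}\big(g(x)\,\partial_y^2\phi\big)\,e^{-S/h}\quad\text{on }\Omega,$$ where $H(x,y,-h\partial_x,-h\partial_y)u=\frac{h^2}2\mathrm{tr}(g\,\partial_y^2u)+h(Gy,\partial_xu)-\frac h2(\frac{\partial}{\partial x}(Gy,y),\partial_yu)$, and this is a multiplicative error $O(h^2)\,t^2u^0$: $$\Big|\Big[h\tfrac{\partial}{\partial t}-H\big(x,y,-h\tfrac{\partial}{\partial x},-h\tfrac{\partial}{\partial y}\big)\Big]u^0\Big|\le K\,h^2\,t^2\,|u^0|$$ for all $h>0$, $0<t<T$, $|x-x_0|\le\rho$, $|y-y_0|\le\rho/t$. -/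

import Mathlib

open scoped ENNReal InnerProductSpace Topology ContDiff

noncomputable section

namespace WKB

/-- Configuration space `ℝ^d`; both the positions `x` and the fibre variables `y` of the cotangent
bundle live here (local coordinates). -/
abbrev E (d : ℕ) : Type := EuclideanSpace ℝ (Fin d)

/-- Phase space over the cotangent bundle; points are `(x, y, p, q)`, with `p` conjugate to `x` and
`q` conjugate to `y`. -/
abbrev Phase (d : ℕ) : Type := E d × E d × E d × E d

variable {d : ℕ}

/-- A smooth field of symmetric positive definite matrices on `ℝ^d`. -/
structure IsMetric (g : E d → E d →L[ℝ] E d) : Prop where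
  smooth : ContDiff ℝ ∞ g
  symm : ∀ x v w, ⟪g x v, w⟫_ℝ = ⟪v, g x w⟫_ℝ
  pos : ∀ x v, v ≠ 0 → 0 < ⟪g x v, v⟫_ℝ

/-- `G(x) = g(x)⁻¹`. -/
def coG (g : E d → E d →L[ℝ] E d) (x : E d) : E d →L[ℝ] E d := (g x).inverse

/-- The vector `∂/∂x (G(x) y, y)`. -/
def force (g : E d → E d →L[ℝ] E d) (x y : E d) : E d :=
  gradient (fun x' => ⟪coG g x' y, y⟫_ℝ) x

/-- `H(x,y,p,q) = ½ (g(x) q, q) - (G(x) y, p) + ½ (∂/∂x (G(x) y, y), q)`. -/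
def ham (g : E d → E d →L[ℝ] E d) (x y p q : E d) : ℝ :=
  (1 / 2) * ⟪g x q, q⟫_ℝ - ⟪coG g x y, p⟫_ℝ + (1 / 2) * ⟪force g x y, q⟫_ℝ

/-- The Hamiltonian vector field `(∂H/∂p, ∂H/∂q, -∂H/∂x, -∂H/∂y)`. -/
def hamField (g : E d → E d →L[ℝ] E d) (z : Phase d) : Phase d :=
  (gradient (fun p => ham g z.1 z.2.1 p z.2.2.2) z.2.2.1,
   gradient (fun q => ham g z.1 z.2.1 z.2.2.1 q) z.2.2.2,
   -gradient (fun x => ham g x z.2.1 z.2.2.1 z.2.2.2) z.1,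
   -gradient (fun y => ham g z.1 y z.2.2.1 z.2.2.2) z.2.1)

/-- `γ` solves Hamilton's equations on `[0, t]` with `γ 0 = (x₀, y₀, p₀, q₀)`, `ζ = (p₀, q₀)`. -/
structure IsCharacteristic (g : E d → E d →L[ℝ] E d) (t : ℝ) (x₀ y₀ : E d) (ζ : E d × E d)
    (γ : ℝ → Phase d) : Prop where
  init : γ 0 = (x₀, y₀, ζ.1, ζ.2)
  ode : ∀ s ∈ Set.Icc 0 t, HasDerivWithinAt γ (hamField g (γ s)) (Set.Icc 0 t) s

/-- The action `∫₀ᵗ (p dx + q dy - H ds)` along a solution of Hamilton's equations. -/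
def action (g : E d → E d →L[ℝ] E d) (t : ℝ) (γ : ℝ → Phase d) : ℝ :=
  ∫ s in (0 : ℝ)..t,
    (⟪(γ s).2.2.1, (hamField g (γ s)).1⟫_ℝ + ⟪(γ s).2.2.2, (hamField g (γ s)).2.1⟫_ℝ
      - ham g (γ s).1 (γ s).2.1 (γ s).2.2.1 (γ s).2.2.2)

open Classical in
/-- The endpoint map `(p₀, q₀) ↦ (X, Y)(t, x₀, y₀, p₀, q₀)` of the characteristics issuing from
`(x₀, y₀)` (only meaningful where the characteristic exists up to time `t`). -/
def endpoint (g : E d → E d →L[ℝ] E d) (t : ℝ) (x₀ y₀ : E d) (ζ : E d × E d) : E d × E d :=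
  if h : ∃ γ, IsCharacteristic g t x₀ y₀ ζ γ then
    ((Classical.choose h t).1, (Classical.choose h t).2.1)
  else 0

/-- The Jacobian `J = det ∂(X,Y)/∂(p₀,q₀)`. -/
def jac (g : E d → E d →L[ℝ] E d) (t : ℝ) (x₀ y₀ : E d) (ζ : E d × E d) : ℝ :=
  (fderiv ℝ (endpoint g t x₀ y₀) ζ).det

/-- Initial momenta with `t³ |p₀| < c`, `t² |q₀| < c` whose characteristic exists on `[0, t]`.
For `c = ∞` these are all initial momenta of characteristics that exist up to time `t`. -/
def momenta (g : E d → E d →L[ℝ] E d) (c : ℝ≥0∞) (t : ℝ) (x₀ y₀ : E d) : Set (E d × E d) :=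
  {ζ | ENNReal.ofReal (t ^ 3 * ‖ζ.1‖) < c ∧ ENNReal.ofReal (t ^ 2 * ‖ζ.2‖) < c ∧
    ∃ γ, IsCharacteristic g t x₀ y₀ ζ γ}

/-- The open polydisk `B_r(x₀) × B_{r/t}(y₀)`; the whole cotangent bundle for `r = ∞`. -/
def polydisk (r : ℝ≥0∞) (t : ℝ) (x₀ y₀ : E d) : Set (E d × E d) :=
  {z | ENNReal.ofReal ‖z.1 - x₀‖ < r ∧ ENNReal.ofReal (t * ‖z.2 - y₀‖) < r}

/-- Unique nondegenerate solvability of the two-point boundary value problem for Hamilton's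
equations: for `0 < t < T` and every starting point `(x₀, y₀)` with `t |y₀| < b`, each point of the
polydisk of radius `r` is joined to `(x₀, y₀)` in time `t` by a characteristic with initial momenta
in `momenta g c t x₀ y₀`, and on that set the endpoint map is injective with nonzero Jacobian.
For `b = c = r = ∞` this is solvability in the whole cotangent bundle. -/
structure UniquelySolvable (g : E d → E d →L[ℝ] E d) (T : ℝ) (b c r : ℝ≥0∞) (x₀ : E d) :
    Prop where
  inj : ∀ t ∈ Set.Ioo 0 T, ∀ y₀ : E d, ENNReal.ofReal (t * ‖y₀‖) < b →
    Set.InjOn (endpoint g t x₀ y₀) (momenta g c t x₀ y₀)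
  jac_ne : ∀ t ∈ Set.Ioo 0 T, ∀ y₀ : E d, ENNReal.ofReal (t * ‖y₀‖) < b →
    ∀ ζ ∈ momenta g c t x₀ y₀, jac g t x₀ y₀ ζ ≠ 0
  surj : ∀ t ∈ Set.Ioo 0 T, ∀ y₀ : E d, ENNReal.ofReal (t * ‖y₀‖) < b →
    polydisk r t x₀ y₀ ⊆ endpoint g t x₀ y₀ '' momenta g c t x₀ y₀

/-- The set of all `(t, x, y)`, `0 < t < T`, reached by the characteristics from `(x₀, y₀)`;
it is `(0,T) × ℝ^{2d}` if `c = ∞` and the boundary value problem is solvable for all end points. -/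
def reached (g : E d → E d →L[ℝ] E d) (T : ℝ) (c : ℝ≥0∞) (x₀ y₀ : E d) : Set (ℝ × E d × E d) :=
  {z | z.1 ∈ Set.Ioo 0 T ∧ z.2 ∈ endpoint g z.1 x₀ y₀ '' momenta g c z.1 x₀ y₀}

/-- `∂u/∂x`. -/
def gradX (u : ℝ → E d → E d → ℝ) (t : ℝ) (x y : E d) : E d := gradient (fun x' => u t x' y) x

/-- `∂u/∂y`. -/
def gradY (u : ℝ → E d → E d → ℝ) (t : ℝ) (x y : E d) : E d := gradient (fun y' => u t x y') y

/-- `∂u/∂t`. -/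
def derivT (u : ℝ → E d → E d → ℝ) (t : ℝ) (x y : E d) : ℝ := deriv (fun s => u s x y) t

/-- `tr (g(x) ∂²u/∂y²)`. -/
def trHessY (g : E d → E d →L[ℝ] E d) (u : ℝ → E d → E d → ℝ) (t : ℝ) (x y : E d) : ℝ :=
  LinearMap.trace ℝ (E d) ((g x ∘L fderiv ℝ (fun y' => gradY u t x y') y : E d →L[ℝ] E d) :
    E d →ₗ[ℝ] E d)

/-- `H(x, y, -h ∂/∂x, -h ∂/∂y) u`, the derivatives acting first. -/
def hamOp (g : E d → E d →L[ℝ] E d) (h : ℝ) (u : ℝ → E d → E d → ℝ) (t : ℝ) (x y : E d) : ℝ :=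
  h ^ 2 / 2 * trHessY g u t x y + h * ⟪coG g x y, gradX u t x y⟫_ℝ
    - h / 2 * ⟪force g x y, gradY u t x y⟫_ℝ

/-- `[h ∂/∂t - H(x, y, -h ∂/∂x, -h ∂/∂y)] u`. -/
def parabolicOp (g : E d → E d →L[ℝ] E d) (h : ℝ) (u : ℝ → E d → E d → ℝ) (t : ℝ) (x y : E d) :
    ℝ :=
  h * derivT u t x y - hamOp g h u t x y

/-- `S` is the two-point function issuing from `(x₀, y₀)`: its value at a point is the action of the
characteristic from `(x₀, y₀)` to that point. -/
def IsTwoPointFunction (g : E d → E d →L[ℝ] E d) (T : ℝ) (c : ℝ≥0∞) (x₀ y₀ : E d)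
    (S : ℝ → E d → E d → ℝ) : Prop :=
  ∀ t ∈ Set.Ioo 0 T, ∀ ζ ∈ momenta g c t x₀ y₀, ∀ γ, IsCharacteristic g t x₀ y₀ ζ γ →
    S t (γ t).1 (γ t).2.1 = action g t γ

/-- The Hamilton–Jacobi equation `∂S/∂t + H(x, y, ∂S/∂x, ∂S/∂y) = 0` on `Ω`. -/
def HamiltonJacobi (g : E d → E d →L[ℝ] E d) (Ω : Set (ℝ × E d × E d))
    (S : ℝ → E d → E d → ℝ) : Prop :=
  ∀ t x y, (t, x, y) ∈ Ω → derivT S t x y + ham g x y (gradX S t x y) (gradY S t x y) = 0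

/-- The transport equation on `Ω`. -/
def Transport (g : E d → E d →L[ℝ] E d) (Ω : Set (ℝ × E d × E d))
    (S φ : ℝ → E d → E d → ℝ) : Prop :=
  ∀ t x y, (t, x, y) ∈ Ω →
    derivT φ t x y + ⟪g x (gradY S t x y), gradY φ t x y⟫_ℝ
      + (1 / 2) * φ t x y * trHessY g S t x y
      - ⟪coG g x y, gradX φ t x y⟫_ℝ + (1 / 2) * ⟪force g x y, gradY φ t x y⟫_ℝ = 0

/-- The ansatz `u⁰ = C(h) φ exp(-S/h)`. -/
def ansatz (C : ℝ → ℝ) (S φ : ℝ → E d → E d → ℝ) (h : ℝ) (t : ℝ) (x y : E d) : ℝ :=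
  C h * φ t x y * Real.exp (-(S t x y) / h)

end WKB

end

/-! Two facts carry the proof: the WKB cancellation, and a scaling symmetry of the characteristics
that turns the remainder into `t²` times something bounded.

Cancellation. Inserting `C φ e^{-S/h}` into the operator, the terms of order `h⁰` sum to `-φ` times
the Hamilton–Jacobi expression and those of order `h¹` to the transport expression, so only the `h²`
term survives (`parabolicOp_ansatz`).

Scaling. Under the weights 0, 1, 3, 2 for `x, y, p, q` the Hamiltonian is homogeneous of degree 4,
and conjugate weights add up to 3. Hence the dilation by `t` carries a characteristic on `[0, t]` to
one on `[0, 1]` starting at `(x₀, t y₀)` (`IsMetric.hamField_dil`, `IsMetric.isCharacteristic_dil`),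
and `J(t)` is `t^{4d}` times the time-one Jacobian at the dilated data (`IsMetric.jac_dil`).
Solvability for all `t` becomes a statement about one smooth map at time 1, with the starting fibre
point as a parameter. Its inverse is smooth by the inverse function theorem.

Amplitude. Differentiating the action in the initial momenta shows that `∂S` is the terminal
momentum (`IsMetric.gradient_twoPoint`). The projected characteristics therefore follow a vector
field on configuration space. Its divergence is exactly `tr(g ∂_y²S)`, because the contributions of
`-G y` and of half the force cancel (`IsMetric.exists_fderiv_velocity`). Liouville's formula and the
transport equation then make `φ √|J|` constant along characteristics. The limit at `t → 0`
identifies this constant, and `φ = k(t) · profile(t y₀, x, t y)` with one fixed smooth positive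
profile `|J|^{-1/2}` (`UniquelySolvable.amplitude_eq_profile`).

Two `y`-derivatives of a function of `t y` produce the factor `t²`. The factor `k(t)` cancels in the
quotient by `φ`, and what remains is a continuous quotient on a compact set of rescaled data, whose
bound gives a `K` independent of `y₀`, `S`, `φ`, `C` and `h`.

The regularity of characteristics is obtained by applying the inverse function theorem to the
integral equation on a space of continuous curves (`exists_smooth_curves`). -/

noncomputable section

namespace WKB

/-! ### Superposition operators on spaces of continuous maps -/

section Superposition

universe u

variable {X : Type*} [TopologicalSpace X] [CompactSpace X]
variable {F : Type u} [NormedAddCommGroup F] [NormedSpace ℝ F]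
variable {F₂ : Type u} [NormedAddCommGroup F₂] [NormedSpace ℝ F₂]

/-- Pointwise application `A h : s ↦ A s (h s)` of continuous families of operators. -/
def pointwiseApply : C(X, F →L[ℝ] F₂) →L[ℝ] C(X, F) →L[ℝ] C(X, F₂) :=
  LinearMap.mkContinuous₂
    (LinearMap.mk₂ ℝ
      (fun (A : C(X, F →L[ℝ] F₂)) (h : C(X, F)) =>
        (⟨fun s => A s (h s), A.continuous.clm_apply h.continuous⟩ : C(X, F₂)))
      (fun _ _ _ => by ext; simp) (fun _ _ _ => by ext; simp)
      (fun _ _ _ => by ext; simp) (fun _ _ _ => by ext; simp)) 1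
    (fun A h => by
      rw [one_mul, ContinuousMap.norm_le _ (by positivity)]
      intro s
      exact ((A s).le_opNorm _).trans (mul_le_mul (A.norm_coe_le_norm s) (h.norm_coe_le_norm s)
        (norm_nonneg _) (norm_nonneg A)))

@[simp]
theorem pointwiseApply_apply (A : C(X, F →L[ℝ] F₂)) (h : C(X, F)) (s : X) :
    pointwiseApply A h s = A s (h s) := rfl

/-- On a compact domain, composition with `V'` is continuous in the sup norm, so `V'` is uniformly
close to `V' (γ s)` on every segment from `γ s` to `γ s + h s`. The mean value inequality on these
segments then gives a remainder that is uniform in `s`. -/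
theorem hasFDerivAt_postcomp {V : F → F₂} {V' : F → F →L[ℝ] F₂} (hc : Continuous V)
    (hc' : Continuous V') (hV : ∀ z, HasFDerivAt V (V' z) z) (γ : C(X, F)) :
    HasFDerivAt (fun γ : C(X, F) => (⟨V, hc⟩ : C(F, F₂)).comp γ)
      (pointwiseApply ((⟨V', hc'⟩ : C(F, F →L[ℝ] F₂)).comp γ)) γ := by
  rw [hasFDerivAt_iff_isLittleO_nhds_zero, Asymptotics.isLittleO_iff]
  intro ε hε
  have hcont := (ContinuousMap.continuous_postcomp (X := X)
    (⟨V', hc'⟩ : C(F, F →L[ℝ] F₂))).tendsto γ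
  obtain ⟨δ, hδ, hball⟩ :=
    Metric.tendsto_nhds_nhds (α := C(X, F)) (β := C(X, F →L[ℝ] F₂)).1 hcont ε hε
  filter_upwards [Metric.ball_mem_nhds (0 : C(X, F)) hδ] with h hh
  rw [mem_ball_zero_iff] at hh
  rw [ContinuousMap.norm_le _ (by positivity)]
  intro s
  have key : ∀ w ∈ segment ℝ (γ s) (γ s + h s), ‖V' w - V' (γ s)‖ ≤ ε := by
    intro w hw
    rw [segment_eq_image'] at hw
    obtain ⟨θ, hθ, rfl⟩ := hw
    have h1 : dist (γ + θ • h) γ < δ := by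
      rw [dist_eq_norm, add_sub_cancel_left, norm_smul, Real.norm_of_nonneg hθ.1]
      exact (mul_le_of_le_one_left (norm_nonneg _) hθ.2).trans_lt hh
    have h2 := (ContinuousMap.dist_le hε.le).1 (hball h1).le s
    rw [dist_eq_norm] at h2
    simpa using h2
  have := (convex_segment (𝕜 := ℝ) (γ s) (γ s + h s)).norm_image_sub_le_of_norm_hasFDerivWithin_le
    (f := fun w => V w - V' (γ s) w) (f' := fun w => V' w - V' (γ s))
    (fun w _ => ((hV w).sub (V' (γ s)).hasFDerivAt).hasFDerivWithinAt) key
    (left_mem_segment ℝ _ _) (right_mem_segment ℝ _ _)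
  have h3 : ‖h s‖ ≤ ‖h‖ := h.norm_coe_le_norm s
  calc _ = ‖V (γ s + h s) - V' (γ s) (γ s + h s) - (V (γ s) - V' (γ s) (γ s))‖ := by
        congr 1
        simp only [ContinuousMap.sub_apply, ContinuousMap.comp_apply, ContinuousMap.add_apply,
          ContinuousMap.coe_mk, pointwiseApply_apply, map_add]
        abel
    _ ≤ ε * ‖γ s + h s - γ s‖ := this
    _ ≤ ε * ‖h‖ := by rw [add_sub_cancel_left]; gcongr

/-- The derivative is again a superposition operator, now with symbol `V'`, followed by the
continuous linear `pointwiseApply`, so induction applies. The target space changes from `F₂` to `F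
→L[ℝ] F₂` at each step and is therefore quantified inside the induction, within a single universe.
-/
theorem contDiff_postcomp_nat (n : ℕ) :
    ∀ {F₂ : Type u} [NormedAddCommGroup F₂] [NormedSpace ℝ F₂] (V : C(F, F₂)),
      ContDiff ℝ n V → ContDiff ℝ n (fun γ : C(X, F) => V.comp γ) := by
  induction n with
  | zero =>
    intro F₂ _ _ V _
    exact contDiff_zero.2 (ContinuousMap.continuous_postcomp V)
  | succ n ih =>
    intro F₂ _ _ V hV
    push_cast at hV ⊢
    obtain ⟨V', hV', hd⟩ := contDiff_succ_iff_hasFDerivAt.1 hV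
    refine contDiff_succ_iff_hasFDerivAt.2 ⟨_, ?_, hasFDerivAt_postcomp V.continuous
      hV'.continuous hd⟩
    exact pointwiseApply.contDiff.comp (ih ⟨V', hV'.continuous⟩ hV')

theorem contDiff_postcomp (V : C(F, F₂)) (hV : ContDiff ℝ ∞ V) :
    ContDiff ℝ ∞ (fun γ : C(X, F) => V.comp γ) :=
  contDiff_infty.2 fun n => contDiff_postcomp_nat n V (contDiff_infty.1 hV n)

end Superposition

/-! ### The Volterra operator -/

section Volterra

variable {F : Type*} [NormedAddCommGroup F]
variable {t : ℝ} (ht : 0 ≤ t)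

/-- Extension of a curve on `[0, t]` to the real line, constant outside. -/
def extendCurve (f : C(Set.Icc 0 t, F)) (s : ℝ) : F := f (Set.projIcc 0 t ht s)

theorem continuous_extendCurve (f : C(Set.Icc 0 t, F)) : Continuous (extendCurve ht f) :=
  f.continuous.comp continuous_projIcc

theorem extendCurve_of_mem (f : C(Set.Icc 0 t, F)) {s : ℝ} (hs : s ∈ Set.Icc 0 t) :
    extendCurve ht f s = f ⟨s, hs⟩ := by
  rw [extendCurve, Set.projIcc_of_mem ht hs]

theorem norm_extendCurve_le (f : C(Set.Icc 0 t, F)) (s : ℝ) : ‖extendCurve ht f s‖ ≤ ‖f‖ :=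
  f.norm_coe_le_norm _

variable [NormedSpace ℝ F]

/-- `f ↦ ∫₀ˢ f` on continuous curves on `[0, t]`. -/
def volterra : C(Set.Icc 0 t, F) →L[ℝ] C(Set.Icc 0 t, F) :=
  LinearMap.mkContinuous
    { toFun := fun f => ⟨fun s => ∫ r in (0 : ℝ)..s, extendCurve ht f r,
        (intervalIntegral.continuous_primitive
          (fun _ _ => (continuous_extendCurve ht f).intervalIntegrable _ _) 0).comp
            continuous_subtype_val⟩
      map_add' := fun f g => by
        ext s
        exact intervalIntegral.integral_add
          ((continuous_extendCurve ht f).intervalIntegrable _ _)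
          ((continuous_extendCurve ht g).intervalIntegrable _ _)
      map_smul' := fun c f => by
        ext s
        exact intervalIntegral.integral_smul c _ } t
    (fun f => by
      rw [ContinuousMap.norm_le _ (by positivity)]
      intro s
      have := intervalIntegral.norm_integral_le_of_norm_le_const (a := 0) (b := s)
        (fun r _ => norm_extendCurve_le ht f r)
      refine this.trans ?_
      rw [sub_zero, abs_of_nonneg s.2.1, mul_comm]
      gcongr
      exact s.2.2)

theorem volterra_apply (f : C(Set.Icc 0 t, F)) (s : Set.Icc 0 t) :
    volterra ht f s = ∫ r in (0 : ℝ)..s, extendCurve ht f r := rfl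

theorem hasDerivAt_integral_extendCurve [CompleteSpace F] (f : C(Set.Icc 0 t, F)) (s : ℝ) :
    HasDerivAt (fun s => ∫ r in (0 : ℝ)..s, extendCurve ht f r) (extendCurve ht f s) s :=
  ((continuous_extendCurve ht f).integral_hasStrictDerivAt 0 s).hasDerivAt

/-- Each iteration integrates the previous bound once more, which creates the factorial. The bound
must be kept pointwise in `s` for the induction to gain it. -/
theorem norm_volterra_pow_le (A : C(Set.Icc 0 t, F →L[ℝ] F)) (h : C(Set.Icc 0 t, F)) (n : ℕ)
    (s : Set.Icc 0 t) :
    ‖(((volterra ht).comp (pointwiseApply A)) ^ n) h s‖ ≤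
      (‖A‖ * s) ^ n / n.factorial * ‖h‖ := by
  induction n generalizing s with
  | zero => simpa using h.norm_coe_le_norm s
  | succ n ih =>
    rw [pow_succ', mul_apply_eq_comp, ContinuousLinearMap.comp_apply, volterra_apply]
    have hb : ∀ r ∈ Set.Ioc (0 : ℝ) s,
        ‖extendCurve ht (pointwiseApply A
          ((((volterra ht).comp (pointwiseApply A)) ^ n) h)) r‖ ≤
        ‖A‖ * ((‖A‖ * r) ^ n / n.factorial * ‖h‖) := by
      intro r hr
      have hr' : r ∈ Set.Icc 0 t := ⟨hr.1.le, hr.2.trans s.2.2⟩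
      rw [extendCurve_of_mem ht _ hr', pointwiseApply_apply]
      exact ((A _).le_opNorm _).trans (mul_le_mul (A.norm_coe_le_norm _) (ih ⟨r, hr'⟩)
        (norm_nonneg _) (norm_nonneg A))
    refine (intervalIntegral.norm_integral_le_of_norm_le s.2.1
      (Filter.Eventually.of_forall hb) (Continuous.intervalIntegrable (by fun_prop) _ _)).trans ?_
    have h1 : ∀ r : ℝ, ‖A‖ * ((‖A‖ * r) ^ n / n.factorial * ‖h‖) =
        (‖A‖ ^ (n + 1) / n.factorial * ‖h‖) * r ^ n := fun r => by ring
    simp_rw [h1]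
    rw [intervalIntegral.integral_const_mul, integral_pow, Nat.factorial_succ]
    push_cast
    apply le_of_eq
    have h2 : (n.factorial : ℝ) ≠ 0 := by positivity
    have h3 : (n : ℝ) + 1 ≠ 0 := by positivity
    field_simp
    ring

/-- No smallness of `A` or `t` is needed: the factorial makes some power `K ^ n` a contraction, and
`1 - K` is a commuting factor of the unit `1 - K ^ n`. -/
theorem isUnit_one_sub_volterra [CompleteSpace F] (A : C(Set.Icc 0 t, F →L[ℝ] F)) :
    IsUnit (1 - (volterra ht).comp (pointwiseApply A)) := by
  set K := (volterra ht).comp (pointwiseApply A)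
  have hlim := FloorSemiring.tendsto_pow_div_factorial_atTop (‖A‖ * t)
  obtain ⟨n, hn⟩ := (hlim.eventually (gt_mem_nhds (show (0 : ℝ) < 1 / 2 by norm_num))).exists
  have hK : ‖K ^ n‖ ≤ 1 / 2 := by
    refine ContinuousLinearMap.opNorm_le_bound _ (by norm_num) fun h => ?_
    rw [ContinuousMap.norm_le _ (by positivity)]
    intro s
    refine (norm_volterra_pow_le ht A h n s).trans ?_
    refine mul_le_mul_of_nonneg_right (le_trans ?_ hn.le) (norm_nonneg h)
    have := s.2.1
    gcongr
    exact s.2.2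
  have h1 : IsUnit (1 - K ^ n) := isUnit_one_sub_of_norm_lt_one
    (R := C(Set.Icc 0 t, F) →L[ℝ] C(Set.Icc 0 t, F)) (hK.trans_lt (by norm_num))
  rw [← mul_neg_geom_sum] at h1
  refine ((Commute.isUnit_mul_iff ?_).1 h1).1
  exact Commute.sum_right _ _ _ fun i _ =>
    ((Commute.one_left _).sub_left ((Commute.refl K).pow_right i))

end Volterra

/-! ### Smooth dependence of solutions of ordinary differential equations on initial values -/

section Flow

variable {F : Type} [NormedAddCommGroup F] [NormedSpace ℝ F]

/-- `γ` solves `γ' = V(γ)` on `[0, t]` with `γ 0 = z`. -/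
structure IsSolution (V : F → F) (t : ℝ) (z : F) (γ : ℝ → F) : Prop where
  init : γ 0 = z
  ode : ∀ s ∈ Set.Icc 0 t, HasDerivWithinAt γ (V (γ s)) (Set.Icc 0 t) s

namespace IsSolution

variable {V : F → F} {t : ℝ} {z : F} {γ γ₁ γ₂ : ℝ → F}

theorem continuousOn (h : IsSolution V t z γ) : ContinuousOn γ (Set.Icc 0 t) :=
  fun s hs => (h.ode s hs).continuousWithinAt

theorem mono (h : IsSolution V t z γ) {s : ℝ} (hs : s ≤ t) : IsSolution V s z γ :=
  ⟨h.init, fun r hr => (h.ode r ⟨hr.1, hr.2.trans hs⟩).mono (Set.Icc_subset_Icc_right hs)⟩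

/-- `V` is only locally Lipschitz, but it is Lipschitz on the compact union of the two trajectories,
which is all that Grönwall's argument uses. -/
theorem eqOn (hV : ContDiff ℝ 1 V) (h₁ : IsSolution V t z γ₁) (h₂ : IsSolution V t z γ₂) :
    Set.EqOn γ₁ γ₂ (Set.Icc 0 t) := by
  obtain ⟨K, hK⟩ := LocallyLipschitzOn.exists_lipschitzOnWith_of_compact
    ((isCompact_Icc.image_of_continuousOn h₁.continuousOn).union
      (isCompact_Icc.image_of_continuousOn h₂.continuousOn))
    (hV.locallyLipschitz.locallyLipschitzOn)
  have hd : ∀ {γ : ℝ → F}, IsSolution V t z γ → ∀ s ∈ Set.Ico 0 t,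
      HasDerivWithinAt γ (V (γ s)) (Set.Ici s) s := fun h s hs =>
    (h.ode s ⟨hs.1, hs.2.le⟩).mono_of_mem_nhdsWithin (mem_nhdsWithin.2
      ⟨Set.Iio t, isOpen_Iio, hs.2, fun r hr => ⟨hs.1.trans hr.2, (le_of_lt hr.1)⟩⟩)
  exact ODE_solution_unique_of_mem_Icc_right (v := fun _ => V) (fun _ _ => hK) h₁.continuousOn
    (hd h₁) (fun s hs => Or.inl ⟨s, ⟨hs.1, hs.2.le⟩, rfl⟩) h₂.continuousOn (hd h₂)
    (fun s hs => Or.inr ⟨s, ⟨hs.1, hs.2.le⟩, rfl⟩) (h₁.init.trans h₂.init.symm)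

end IsSolution

variable {V : F → F} {t : ℝ}

theorem isSolution_extendCurve [CompleteSpace F] (ht : 0 ≤ t) (hV : Continuous V) {z : F}
    {c : C(Set.Icc 0 t, F)}
    (hc : c = ContinuousMap.const _ z + volterra ht ((⟨V, hV⟩ : C(F, F)).comp c)) :
    IsSolution V t z (extendCurve ht c) := by
  have heq : ∀ s ∈ Set.Icc 0 t, extendCurve ht c s =
      z + ∫ r in (0 : ℝ)..s, extendCurve ht ((⟨V, hV⟩ : C(F, F)).comp c) r := by
    intro s hs
    rw [extendCurve_of_mem ht c hs]
    conv_lhs => rw [hc]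
    rfl
  refine ⟨by simpa using heq 0 ⟨le_rfl, ht⟩, fun s hs => ?_⟩
  refine HasDerivWithinAt.congr ?_ heq (heq s hs)
  exact ((hasDerivAt_integral_extendCurve ht _ s).const_add z).hasDerivWithinAt

theorem IsSolution.integral_eq [CompleteSpace F] (hV : Continuous V) {z : F}
    {γ : ℝ → F} (h : IsSolution V t z γ) {s : ℝ} (hs : s ∈ Set.Icc 0 t) :
    γ s = z + ∫ r in (0 : ℝ)..s, V (γ r) := by
  have hsub : Set.Icc 0 s ⊆ Set.Icc 0 t := Set.Icc_subset_Icc_right hs.2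
  rw [intervalIntegral.integral_eq_sub_of_hasDerivAt_of_le hs.1 (h.continuousOn.mono hsub)
    (fun r hr => (h.ode r (hsub ⟨hr.1.le, hr.2.le⟩)).hasDerivAt
      (Icc_mem_nhds hr.1 (hr.2.trans_le hs.2)))]
  · rw [h.init]; abel
  · apply ContinuousOn.intervalIntegrable
    rw [Set.uIcc_of_le hs.1]
    exact hV.comp_continuousOn (h.continuousOn.mono hsub)

/-- The restriction of a solution to `[0, t]` as a continuous map. -/
def IsSolution.toCurve {z : F} {γ : ℝ → F} (h : IsSolution V t z γ) : C(Set.Icc 0 t, F) :=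
  ⟨fun s => γ s, continuousOn_iff_continuous_domRestrict.1 h.continuousOn⟩

theorem IsSolution.toCurve_eq [CompleteSpace F] (ht : 0 ≤ t) (hV : Continuous V) {z : F}
    {γ : ℝ → F} (h : IsSolution V t z γ) :
    h.toCurve = ContinuousMap.const _ z + volterra ht ((⟨V, hV⟩ : C(F, F)).comp h.toCurve) := by
  ext s
  change γ s = z + ∫ r in (0 : ℝ)..s, extendCurve ht ((⟨V, hV⟩ : C(F, F)).comp h.toCurve) r
  rw [h.integral_eq hV s.2]
  congr 1
  refine intervalIntegral.integral_congr fun r hr => ?_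
  rw [Set.uIcc_of_le s.2.1] at hr
  exact (extendCurve_of_mem ht ((⟨V, hV⟩ : C(F, F)).comp h.toCurve)
    ⟨hr.1, hr.2.trans s.2.2⟩).symm

/-- Constant curves, as a continuous linear map. -/
def constCurve (t : ℝ) : F →L[ℝ] C(Set.Icc 0 t, F) :=
  LinearMap.mkContinuous
    { toFun := fun z => ContinuousMap.const _ z
      map_add' := fun _ _ => rfl
      map_smul' := fun _ _ => rfl } 1
    (fun z => by
      rw [one_mul, ContinuousMap.norm_le _ (norm_nonneg z)]
      exact fun _ => le_rfl)

/-- Solutions are the preimages of constant curves under `c ↦ c - ∫ V(c)`. This map is smooth with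
derivative `1 - ∫ V'(c)`, invertible at the given solution. Its local inverse yields smooth
dependence and also the existence of nearby solutions on the whole of `[0, t]`. -/
theorem exists_smooth_curves [CompleteSpace F] (ht : 0 ≤ t) (hV : ContDiff ℝ ∞ V) {z₀ : F}
    {γ : ℝ → F} (h : IsSolution V t z₀ γ) :
    ∃ Γ : F → C(Set.Icc 0 t, F), ContDiffAt ℝ ∞ Γ z₀ ∧ Γ z₀ = h.toCurve ∧
      ∀ᶠ z in 𝓝 z₀, Γ z = constCurve t z +
        volterra ht ((⟨V, hV.continuous⟩ : C(F, F)).comp (Γ z)) := by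
  set N : C(Set.Icc 0 t, F) → C(Set.Icc 0 t, F) := fun c =>
    (⟨V, hV.continuous⟩ : C(F, F)).comp c
  set Φ : C(Set.Icc 0 t, F) → C(Set.Icc 0 t, F) := fun c => c - volterra ht (N c)
  have hN : ContDiff ℝ ∞ N := contDiff_postcomp (⟨V, hV.continuous⟩ : C(F, F)) hV
  have contDiff_volterra : ContDiff ℝ ∞ (volterra (F := F) ht) :=
    ContinuousLinearMap.contDiff (E := C(Set.Icc 0 t, F)) (F := C(Set.Icc 0 t, F)) (volterra ht)
  have hΦ : ContDiff ℝ ∞ Φ := contDiff_id.sub (contDiff_volterra.comp hN)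
  have hdV : Continuous (fderiv ℝ V) := hV.continuous_fderiv (by simp)
  have hNd : HasFDerivAt N (pointwiseApply
      ((⟨fderiv ℝ V, hdV⟩ : C(F, F →L[ℝ] F)).comp h.toCurve)) h.toCurve :=
    hasFDerivAt_postcomp hV.continuous hdV
      (fun z => (hV.differentiable (by simp) z).hasFDerivAt) _
  obtain ⟨e, he⟩ := isUnit_one_sub_volterra ht
    ((⟨fderiv ℝ V, hdV⟩ : C(F, F →L[ℝ] F)).comp h.toCurve)
  have hΦd : HasFDerivAt Φ ((ContinuousLinearEquiv.ofUnit e : _ ≃L[ℝ] _) :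
      C(Set.Icc 0 t, F) →L[ℝ] C(Set.Icc 0 t, F)) h.toCurve := by
    have : HasFDerivAt Φ (1 - (volterra ht).comp (pointwiseApply
        ((⟨fderiv ℝ V, hdV⟩ : C(F, F →L[ℝ] F)).comp h.toCurve))) h.toCurve :=
      (hasFDerivAt_id _).sub (HasFDerivAt.comp h.toCurve
        (ContinuousLinearMap.hasFDerivAt (E := C(Set.Icc 0 t, F)) (F := C(Set.Icc 0 t, F))
          (volterra ht)) hNd)
    rw [← he] at this
    exact this
  have hbase : Φ h.toCurve = constCurve t z₀ :=
    sub_eq_of_eq_add (h.toCurve_eq ht hV.continuous)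
  have hc := hΦ.contDiffAt (x := h.toCurve)
  refine ⟨fun z => hc.localInverse hΦd (by simp) (constCurve t z), ?_, ?_, ?_⟩
  · refine ContDiffAt.comp z₀ ?_ (ContDiff.contDiffAt (ContinuousLinearMap.contDiff
      (F := C(Set.Icc 0 t, F)) (constCurve t)))
    rw [← hbase]
    exact hc.to_localInverse hΦd (by simp)
  · simp only [← hbase]
    exact hc.localInverse_apply_image hΦd (by simp)
  · have h1 := (hc.hasStrictFDerivAt' hΦd (by simp)).eventually_right_inverse
    rw [hbase] at h1
    filter_upwards [((constCurve t).continuous.tendsto z₀).eventually h1] with z hz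
    exact (sub_eq_iff_eq_add.1 hz)

/-- A family of solutions of `γ' = V(γ)` on `[0, t]` depending smoothly on the initial value near
`z₀`; its derivative `D` with respect to the initial value solves the variational equation. -/
structure IsFlowNear (V : F → F) (t : ℝ) (z₀ : F) (Γ : F → ℝ → F) (D : ℝ → F →L[ℝ] F) :
    Prop where
  sol : ∀ᶠ z in 𝓝 z₀, IsSolution V t z (Γ z)
  smooth : ∀ s ∈ Set.Icc 0 t, ContDiffAt ℝ ∞ (fun z => Γ z s) z₀
  deriv : ∀ s ∈ Set.Icc 0 t, HasFDerivAt (fun z => Γ z s) (D s) z₀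
  variation : ∀ δ, ∀ s ∈ Set.Icc 0 t,
    HasDerivWithinAt (fun s => D s δ) (fderiv ℝ V (Γ z₀ s) (D s δ)) (Set.Icc 0 t) s
  variation_zero : D 0 = ContinuousLinearMap.id ℝ F
  integral : ∀ ℓ : F → ℝ, ContDiff ℝ ∞ ℓ → ∃ A : F →L[ℝ] ℝ,
    HasFDerivAt (fun z => ∫ s in (0 : ℝ)..t, ℓ (Γ z s)) A z₀ ∧
      ∀ δ, A δ = ∫ s in (0 : ℝ)..t, fderiv ℝ ℓ (Γ z₀ s) (D s δ)

theorem exists_isFlowNear [CompleteSpace F] (ht : 0 ≤ t) (hV : ContDiff ℝ ∞ V) {z₀ : F}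
    {γ : ℝ → F} (h : IsSolution V t z₀ γ) :
    ∃ Γ D, IsFlowNear V t z₀ Γ D ∧ Set.EqOn (Γ z₀) γ (Set.Icc 0 t) := by
  obtain ⟨Γ, hΓ, hΓ0, hΓeq⟩ := exists_smooth_curves ht hV h
  have hΓd : HasFDerivAt Γ (fderiv ℝ Γ z₀) z₀ := (hΓ.differentiableAt (by simp)).hasFDerivAt
  have hdV : Continuous (fderiv ℝ V) := hV.continuous_fderiv (by simp)
  have hev : ∀ s : Set.Icc 0 t, HasFDerivAt (fun z => Γ z s)
      ((ContinuousMap.evalCLM ℝ s).comp (fderiv ℝ Γ z₀)) z₀ := fun s =>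
    HasFDerivAt.comp z₀ (ContinuousLinearMap.hasFDerivAt (E := C(Set.Icc 0 t, F))
      (ContinuousMap.evalCLM ℝ s)) hΓd
  -- The variational equation in integral form, obtained by differentiating the fixed point equation
  -- for `Γ`.
  have hlin : ∀ δ, fderiv ℝ Γ z₀ δ = constCurve t δ + volterra ht (pointwiseApply
      ((⟨fderiv ℝ V, hdV⟩ : C(F, F →L[ℝ] F)).comp h.toCurve) (fderiv ℝ Γ z₀ δ)) := by
    intro δ
    have hN : HasFDerivAt (fun c => (⟨V, hV.continuous⟩ : C(F, F)).comp c) (pointwiseApply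
        ((⟨fderiv ℝ V, hdV⟩ : C(F, F →L[ℝ] F)).comp h.toCurve)) (Γ z₀) := by
      rw [hΓ0]
      exact hasFDerivAt_postcomp hV.continuous hdV
        (fun z => (hV.differentiable (by simp) z).hasFDerivAt) _
    have h1 : HasFDerivAt (fun z => constCurve t z +
        volterra ht ((⟨V, hV.continuous⟩ : C(F, F)).comp (Γ z)))
        (constCurve t + (volterra ht).comp ((pointwiseApply
        ((⟨fderiv ℝ V, hdV⟩ : C(F, F →L[ℝ] F)).comp h.toCurve)).comp (fderiv ℝ Γ z₀))) z₀ :=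
      HasFDerivAt.add (ContinuousLinearMap.hasFDerivAt (F := C(Set.Icc 0 t, F)) (constCurve t))
        (HasFDerivAt.comp z₀
          (ContinuousLinearMap.hasFDerivAt (E := C(Set.Icc 0 t, F)) (F := C(Set.Icc 0 t, F))
            (volterra ht)) (hN.comp z₀ hΓd))
    exact DFunLike.congr_fun ((h1.congr_of_eventuallyEq hΓeq).unique hΓd).symm δ
  have hγ : ∀ s (hs : s ∈ Set.Icc 0 t), extendCurve ht (Γ z₀) s = γ s := by
    intro s hs
    rw [extendCurve_of_mem ht _ hs, hΓ0]
    rfl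
  have hDeq : ∀ δ, ∀ s ∈ Set.Icc 0 t, extendCurve ht (fderiv ℝ Γ z₀ δ) s =
      δ + ∫ r in (0 : ℝ)..s, extendCurve ht (pointwiseApply
        ((⟨fderiv ℝ V, hdV⟩ : C(F, F →L[ℝ] F)).comp h.toCurve) (fderiv ℝ Γ z₀ δ)) r := by
    intro δ s hs
    rw [extendCurve_of_mem ht _ hs]
    conv_lhs => rw [hlin δ]
    rfl
  refine ⟨fun z => extendCurve ht (Γ z),
    fun s => (ContinuousMap.evalCLM ℝ (Set.projIcc 0 t ht s)).comp (fderiv ℝ Γ z₀),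
    ⟨?_, ?_, ?_, ?_, ?_, ?_⟩, fun s hs => hγ s hs⟩
  · filter_upwards [hΓeq] with z hz
    exact isSolution_extendCurve ht hV.continuous hz
  · intro s _
    exact ContDiffAt.comp z₀ (ContDiff.contDiffAt (ContinuousLinearMap.contDiff
      (E := C(Set.Icc 0 t, F)) (ContinuousMap.evalCLM ℝ (Set.projIcc 0 t ht s)))) hΓ
  · exact fun s _ => hev _
  · intro δ s hs
    refine HasDerivWithinAt.congr ?_ (hDeq δ) (hDeq δ s hs)
    have h2 := ((hasDerivAt_integral_extendCurve ht (pointwiseApply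
        ((⟨fderiv ℝ V, hdV⟩ : C(F, F →L[ℝ] F)).comp h.toCurve) (fderiv ℝ Γ z₀ δ))
        s).const_add δ).hasDerivWithinAt (s := Set.Icc 0 t)
    convert h2 using 1
    rw [hγ s hs, extendCurve_of_mem ht _ hs]
    simp only [ContinuousLinearMap.comp_apply, Set.projIcc_of_mem ht hs]
    rfl
  · ext δ
    have h0 := hDeq δ 0 ⟨le_rfl, ht⟩
    rwa [intervalIntegral.integral_same, add_zero] at h0
  · intro ℓ hℓ
    have hdℓ : Continuous (fderiv ℝ ℓ) := hℓ.continuous_fderiv (by simp)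
    have hN : HasFDerivAt (fun c => (⟨ℓ, hℓ.continuous⟩ : C(F, ℝ)).comp c) (pointwiseApply
        ((⟨fderiv ℝ ℓ, hdℓ⟩ : C(F, F →L[ℝ] ℝ)).comp (Γ z₀))) (Γ z₀) :=
      hasFDerivAt_postcomp hℓ.continuous hdℓ
        (fun z => (hℓ.differentiable (by simp) z).hasFDerivAt) _
    have h1 : HasFDerivAt (fun z => volterra ht ((⟨ℓ, hℓ.continuous⟩ : C(F, ℝ)).comp (Γ z))
          ⟨t, ht, le_rfl⟩)
        ((ContinuousMap.evalCLM ℝ (⟨t, ht, le_rfl⟩ : Set.Icc 0 t)).comp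
          ((volterra ht).comp ((pointwiseApply
          ((⟨fderiv ℝ ℓ, hdℓ⟩ : C(F, F →L[ℝ] ℝ)).comp (Γ z₀))).comp (fderiv ℝ Γ z₀)))) z₀ :=
      HasFDerivAt.comp z₀ (ContinuousLinearMap.hasFDerivAt (E := C(Set.Icc 0 t, ℝ))
        (ContinuousMap.evalCLM ℝ (⟨t, ht, le_rfl⟩ : Set.Icc 0 t)))
        (HasFDerivAt.comp z₀
          (ContinuousLinearMap.hasFDerivAt (E := C(Set.Icc 0 t, ℝ)) (F := C(Set.Icc 0 t, ℝ))
            (volterra ht)) (hN.comp z₀ hΓd))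
    exact ⟨_, h1, fun δ => rfl⟩

end Flow

/-! ### Determinants and traces -/

section Determinant

theorem contDiff_matrix_det {n : Type*} [Fintype n] [DecidableEq n] :
    ContDiff ℝ ∞ (fun m : n → n → ℝ => Matrix.det (Matrix.of m)) := by
  simp only [Matrix.det_apply, Matrix.of_apply]
  refine ContDiff.sum fun σ _ => ?_
  simp only [Units.smul_def, zsmul_eq_mul]
  exact contDiff_const.mul (contDiff_prod fun i _ => by fun_prop)

/-- Compare the chain rule along `1 + r A` with the expansion `det (1 + r A) = 1 + r tr A + O(r²)`.
-/
theorem fderiv_matrix_det_one {n : Type*} [Fintype n] [DecidableEq n] (A : n → n → ℝ) :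
    fderiv ℝ (fun m : n → n → ℝ => Matrix.det (Matrix.of m)) (1 : Matrix n n ℝ) A =
      Matrix.trace (Matrix.of A) := by
  have h1 : HasDerivAt (fun r : ℝ => (fun i j => (1 : Matrix n n ℝ) i j + r * A i j)) A 0 := by
    refine hasDerivAt_pi.2 fun i => hasDerivAt_pi.2 fun j => ?_
    simpa using ((hasDerivAt_id (0 : ℝ)).mul_const (A i j)).const_add ((1 : Matrix n n ℝ) i j)
  have h0 : (fun i j => (1 : Matrix n n ℝ) i j + 0 * A i j) = (1 : Matrix n n ℝ) := by
    ext; simp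
  have h2 : HasFDerivAt (fun m : n → n → ℝ => Matrix.det (Matrix.of m))
      (fderiv ℝ (fun m : n → n → ℝ => Matrix.det (Matrix.of m)) (1 : Matrix n n ℝ))
      (fun i j => (1 : Matrix n n ℝ) i j + 0 * A i j) := by
    rw [h0]
    exact (contDiff_matrix_det.differentiable (by simp) _).hasFDerivAt
  have h3 := h2.comp_hasDerivAt (0 : ℝ) h1
  obtain ⟨q, hq⟩ : ∃ q : Polynomial ℝ, ∀ r : ℝ,
      Matrix.det (Matrix.of fun i j => (1 : Matrix n n ℝ) i j + r * A i j) =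
      1 + Matrix.trace (Matrix.of A) * r + q.eval r * r ^ 2 :=
    ⟨_, fun r => Matrix.det_one_add_smul r (Matrix.of A)⟩
  have h4 : HasDerivAt (fun r : ℝ => 1 + Matrix.trace (Matrix.of A) * r + q.eval r * r ^ 2)
      (Matrix.trace (Matrix.of A)) 0 := by
    have := (((hasDerivAt_id (0 : ℝ)).const_mul (Matrix.trace (Matrix.of A))).const_add 1).add
      ((q.hasDerivAt 0).mul (hasDerivAt_pow 2 (0 : ℝ)))
    exact this.congr_deriv (by simp)
  refine h3.unique (h4.congr_of_eventuallyEq (Filter.Eventually.of_forall fun r => ?_))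
  exact hq r

variable {F : Type*} [NormedAddCommGroup F] [NormedSpace ℝ F]

theorem det_eq_matrix_det {n : Type*} [Fintype n] [DecidableEq n] (b : Module.Basis n ℝ F)
    (M : F →L[ℝ] F) :
    M.det = Matrix.det (Matrix.of fun i j => b.coord i (M (b j))) := by
  rw [ContinuousLinearMap.det, ← LinearMap.det_toMatrix b]
  congr 1
  ext i j
  simp [LinearMap.toMatrix_apply]

variable [FiniteDimensional ℝ F]

theorem contDiff_clm_det : ContDiff ℝ ∞ (fun M : F →L[ℝ] F => M.det) := by
  set b := Module.finBasis ℝ F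
  simp only [det_eq_matrix_det b]
  refine contDiff_matrix_det.comp (contDiff_pi.2 fun i => contDiff_pi.2 fun j => ?_)
  exact (LinearMap.toContinuousLinearMap (b.coord i)).contDiff.comp
    (contDiff_id.clm_apply contDiff_const)

theorem hasDerivAt_det_of_eq_id {M : ℝ → F →L[ℝ] F} {A : F →L[ℝ] F} {s : ℝ}
    (hs : M s = ContinuousLinearMap.id ℝ F)
    (hM : ∀ v, HasDerivAt (fun r => M r v) (A v) s) :
    HasDerivAt (fun r => (M r).det) (LinearMap.trace ℝ F A) s := by
  set b := Module.finBasis ℝ F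
  simp only [det_eq_matrix_det b]
  have h1 : HasDerivAt (fun r => (fun i j => b.coord i (M r (b j))))
      (fun i j => b.coord i (A (b j))) s := by
    refine hasDerivAt_pi.2 fun i => hasDerivAt_pi.2 fun j => ?_
    exact (LinearMap.toContinuousLinearMap (b.coord i)).hasFDerivAt.comp_hasDerivAt s (hM (b j))
  have h0 : (fun i j => b.coord i (M s (b j))) =
      (1 : Matrix (Fin (Module.finrank ℝ F)) (Fin (Module.finrank ℝ F)) ℝ) := by
    ext i j
    simp [hs, Matrix.one_apply, Finsupp.single_apply, eq_comm]
  have h2 := (contDiff_matrix_det.differentiable (by simp)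
    (fun i j => b.coord i (M s (b j)))).hasFDerivAt.comp_hasDerivAt s h1
  refine h2.congr_deriv ?_
  rw [h0, fderiv_matrix_det_one, LinearMap.trace_eq_matrix_trace ℝ b]
  congr 1
  ext i j
  simp [LinearMap.toMatrix_apply]

/-- Liouville's formula. -/
theorem hasDerivAt_det {M : ℝ → F →L[ℝ] F} {A : F →L[ℝ] F} {s : ℝ} (hs : (M s).det ≠ 0)
    (hM : ∀ v, HasDerivAt (fun r => M r v) (A (M s v)) s) :
    HasDerivAt (fun r => (M r).det) (LinearMap.trace ℝ F A * (M s).det) s := by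
  -- Multiplying by the frozen inverse of `M s` reduces to a family that passes through the
  -- identity.
  set e := (M s).toContinuousLinearEquivOfDetNeZero hs
  have he : ∀ v, M s (e.symm v) = v := fun v => e.apply_symm_apply v
  have h1 : HasDerivAt (fun r => ((M r).comp (e.symm : F →L[ℝ] F)).det)
      (LinearMap.trace ℝ F A) s := by
    refine hasDerivAt_det_of_eq_id ?_ fun v => ?_
    · ext v; exact he v
    · simpa [he] using hM (e.symm v)
  have h2 : ∀ r, (M r).det = ((M r).comp (e.symm : F →L[ℝ] F)).det * (M s).det := by
    intro r
    rw [ContinuousLinearMap.det, ContinuousLinearMap.det, ContinuousLinearMap.det,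
      ← LinearMap.det_comp]
    congr 1
    ext v
    change _ = M r (e.symm (e v))
    simp
  rw [show (fun r => (M r).det) = _ from funext h2]
  exact h1.mul_const _

end Determinant

/-- Split `A` into its restrictions to the two summands and use cyclicity of the trace. It separates
the divergence into its `x`- and `y`-parts. -/
theorem trace_prod_eq {F F₂ : Type*} [AddCommGroup F] [Module ℝ F] [Module.Finite ℝ F]
    [AddCommGroup F₂] [Module ℝ F₂] [Module.Finite ℝ F₂] (A : F × F₂ →ₗ[ℝ] F × F₂) :
    LinearMap.trace ℝ (F × F₂) A =
      LinearMap.trace ℝ F (LinearMap.fst ℝ F F₂ ∘ₗ A ∘ₗ LinearMap.inl ℝ F F₂) +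
      LinearMap.trace ℝ F₂ (LinearMap.snd ℝ F F₂ ∘ₗ A ∘ₗ LinearMap.inr ℝ F F₂) := by
  have h : A = (A ∘ₗ LinearMap.inl ℝ F F₂) ∘ₗ LinearMap.fst ℝ F F₂ +
      (A ∘ₗ LinearMap.inr ℝ F F₂) ∘ₗ LinearMap.snd ℝ F F₂ := by
    ext v <;> simp [Prod.mk_zero_zero]
  conv_lhs => rw [h]
  rw [map_add, LinearMap.trace_comp_comm' (A ∘ₗ LinearMap.inl ℝ F F₂),
    LinearMap.trace_comp_comm' (A ∘ₗ LinearMap.inr ℝ F F₂)]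

/-! ### The Hamiltonian vector field -/

section Hamiltonian

variable {d : ℕ}

theorem inner_gradient {f : E d → ℝ} (x v : E d) :
    ⟪gradient f x, v⟫_ℝ = fderiv ℝ f x v := by
  rw [gradient, InnerProductSpace.toDual_symm_apply]

theorem contDiff_of_inner {F : Type*} [NormedAddCommGroup F] [NormedSpace ℝ F] {n : ℕ∞ω}
    {f : F → E d} (h : ∀ v, ContDiff ℝ n fun z => ⟪f z, v⟫_ℝ) : ContDiff ℝ n f := by
  refine contDiff_euclidean.2 fun i => ?_
  simpa [EuclideanSpace.inner_single_right] using h (EuclideanSpace.single i 1)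

theorem contDiffAt_of_inner {F : Type*} [NormedAddCommGroup F] [NormedSpace ℝ F] {n : ℕ∞ω}
    {f : F → E d} {z : F} (h : ∀ v, ContDiffAt ℝ n (fun z => ⟪f z, v⟫_ℝ) z) :
    ContDiffAt ℝ n f z := by
  refine contDiffAt_euclidean.2 fun i => ?_
  simpa [EuclideanSpace.inner_single_right] using h (EuclideanSpace.single i 1)

variable {g : E d → E d →L[ℝ] E d}

theorem IsMetric.exists_equiv (hg : IsMetric g) (x : E d) :
    ∃ e : E d ≃L[ℝ] E d, (e : E d →L[ℝ] E d) = g x := by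
  have hinj : Function.Injective (g x : E d →ₗ[ℝ] E d) := by
    rw [← LinearMap.ker_eq_bot, LinearMap.ker_eq_bot']
    intro v hv
    by_contra hne
    have := hg.pos x v hne
    rw [show g x v = 0 from hv, inner_zero_left] at this
    exact lt_irrefl _ this
  exact ⟨(LinearEquiv.ofInjectiveEndo _ hinj).toContinuousLinearEquiv, by ext; rfl⟩

theorem IsMetric.contDiff_coG (hg : IsMetric g) : ContDiff ℝ ∞ (coG g) := by
  rw [contDiff_iff_contDiffAt]
  intro x
  obtain ⟨e, he⟩ := hg.exists_equiv x
  have h := contDiffAt_map_inverse (𝕜 := ℝ) (n := ∞) e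
  rw [he] at h
  exact h.comp x hg.smooth.contDiffAt

theorem IsMetric.g_coG (hg : IsMetric g) (x v : E d) : g x (coG g x v) = v := by
  obtain ⟨e, he⟩ := hg.exists_equiv x
  rw [coG, ← he, ContinuousLinearMap.inverse_equiv]
  exact e.apply_symm_apply v

theorem IsMetric.coG_symm (hg : IsMetric g) (x v w : E d) :
    ⟪coG g x v, w⟫_ℝ = ⟪v, coG g x w⟫_ℝ := by
  conv_lhs => rw [← hg.g_coG x w]
  conv_rhs => rw [← hg.g_coG x v]
  exact (hg.symm x _ _).symm

theorem IsMetric.hasFDerivAt_coG (hg : IsMetric g) (x : E d) :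
    HasFDerivAt (coG g) (fderiv ℝ (coG g) x) x :=
  (hg.contDiff_coG.differentiable (by simp) x).hasFDerivAt

theorem IsMetric.inner_force (hg : IsMetric g) (x y v : E d) :
    ⟪force g x y, v⟫_ℝ = ⟪fderiv ℝ (coG g) x v y, y⟫_ℝ := by
  rw [force, inner_gradient]
  have h : HasFDerivAt (fun x' => ⟪coG g x' y, y⟫_ℝ) _ x :=
    ((hg.hasFDerivAt_coG x).clm_apply (hasFDerivAt_const y x)).inner ℝ (hasFDerivAt_const y x)
  rw [h.fderiv]
  simp

theorem IsMetric.fderiv_coG_symm (hg : IsMetric g) (x u v w : E d) :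
    ⟪fderiv ℝ (coG g) x u v, w⟫_ℝ = ⟪v, fderiv ℝ (coG g) x u w⟫_ℝ := by
  have h1 : HasFDerivAt (fun x' => ⟪coG g x' v, w⟫_ℝ) _ x :=
    ((hg.hasFDerivAt_coG x).clm_apply (hasFDerivAt_const v x)).inner ℝ (hasFDerivAt_const w x)
  have h2 : HasFDerivAt (fun x' => ⟪v, coG g x' w⟫_ℝ) _ x :=
    (hasFDerivAt_const v x).inner ℝ ((hg.hasFDerivAt_coG x).clm_apply (hasFDerivAt_const w x))
  simp_rw [hg.coG_symm] at h1
  have := DFunLike.congr_fun (h1.unique h2) u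
  simpa using this

/-- Tested against `v`, the force is a quadratic form in `y` whose coefficients depend smoothly on
`x`, and smoothness of a vector-valued map can be tested that way. -/
theorem IsMetric.contDiff_force (hg : IsMetric g) :
    ContDiff ℝ ∞ (fun z : E d × E d => force g z.1 z.2) := by
  refine contDiff_of_inner fun v => ?_
  simp only [hg.inner_force]
  have h1 : ContDiff ℝ ∞ (fderiv ℝ (coG g)) := hg.contDiff_coG.fderiv_right (by simp)
  have h2 : ContDiff ℝ ∞ (fun z : E d × E d => fderiv ℝ (coG g) z.1) := h1.comp contDiff_fst
  exact ((h2.clm_apply contDiff_const).clm_apply contDiff_snd).inner ℝ contDiff_snd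

/-- The Hamiltonian as a function on phase space. -/
def hamFun (g : E d → E d →L[ℝ] E d) (z : Phase d) : ℝ := ham g z.1 z.2.1 z.2.2.1 z.2.2.2

theorem IsMetric.contDiff_hamFun (hg : IsMetric g) : ContDiff ℝ ∞ (hamFun g) := by
  have hx : ContDiff ℝ ∞ (fun z : Phase d => z.1) := contDiff_fst
  have hy : ContDiff ℝ ∞ (fun z : Phase d => z.2.1) := contDiff_snd.fst
  have hp : ContDiff ℝ ∞ (fun z : Phase d => z.2.2.1) := contDiff_snd.snd.fst
  have hq : ContDiff ℝ ∞ (fun z : Phase d => z.2.2.2) := contDiff_snd.snd.snd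
  have hf : ContDiff ℝ ∞ (fun z : Phase d => force g z.1 z.2.1) :=
    ContDiff.comp (g := fun w : E d × E d => force g w.1 w.2)
      (f := fun z : Phase d => (z.1, z.2.1)) hg.contDiff_force (hx.prodMk hy)
  have h1 : ContDiff ℝ ∞ (fun z : Phase d => g z.1 z.2.2.2) := (hg.smooth.comp hx).clm_apply hq
  have h2 : ContDiff ℝ ∞ (fun z : Phase d => coG g z.1 z.2.1) :=
    (hg.contDiff_coG.comp hx).clm_apply hy
  have h3 : ContDiff ℝ ∞ (fun z : Phase d => ⟪g z.1 z.2.2.2, z.2.2.2⟫_ℝ) := h1.inner ℝ hq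
  have h4 : ContDiff ℝ ∞ (fun z : Phase d => ⟪coG g z.1 z.2.1, z.2.2.1⟫_ℝ) := h2.inner ℝ hp
  have h5 : ContDiff ℝ ∞ (fun z : Phase d => ⟪force g z.1 z.2.1, z.2.2.2⟫_ℝ) := hf.inner ℝ hq
  exact ((contDiff_const.mul h3).sub h4).add (contDiff_const.mul h5)

theorem IsMetric.hasFDerivAt_hamFun (hg : IsMetric g) (z : Phase d) :
    HasFDerivAt (hamFun g) (fderiv ℝ (hamFun g) z) z :=
  (hg.contDiff_hamFun.differentiable (by simp) z).hasFDerivAt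

theorem IsMetric.inner_hamField_x (hg : IsMetric g) (z : Phase d) (v : E d) :
    ⟪(hamField g z).1, v⟫_ℝ = fderiv ℝ (hamFun g) z (0, 0, v, 0) := by
  rw [hamField, inner_gradient]
  have hin : HasFDerivAt (fun p => ((z.1, z.2.1, p, z.2.2.2) : Phase d))
      ((0 : E d →L[ℝ] E d).prod ((0 : E d →L[ℝ] E d).prod
        ((ContinuousLinearMap.id ℝ (E d)).prod (0 : E d →L[ℝ] E d)))) z.2.2.1 :=
    (hasFDerivAt_const z.1 _).prodMk ((hasFDerivAt_const z.2.1 _).prodMk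
      ((hasFDerivAt_id _).prodMk (hasFDerivAt_const z.2.2.2 _)))
  have h := HasFDerivAt.comp z.2.2.1 (g := hamFun g) (hg.hasFDerivAt_hamFun z) hin
  exact congrArg (fun L : E d →L[ℝ] ℝ => L v) h.fderiv

theorem IsMetric.inner_hamField_y (hg : IsMetric g) (z : Phase d) (v : E d) :
    ⟪(hamField g z).2.1, v⟫_ℝ = fderiv ℝ (hamFun g) z (0, 0, 0, v) := by
  rw [hamField, inner_gradient]
  have hin : HasFDerivAt (fun q => ((z.1, z.2.1, z.2.2.1, q) : Phase d))
      ((0 : E d →L[ℝ] E d).prod ((0 : E d →L[ℝ] E d).prod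
        ((0 : E d →L[ℝ] E d).prod (ContinuousLinearMap.id ℝ (E d))))) z.2.2.2 :=
    (hasFDerivAt_const z.1 _).prodMk ((hasFDerivAt_const z.2.1 _).prodMk
      ((hasFDerivAt_const z.2.2.1 _).prodMk (hasFDerivAt_id _)))
  have h := HasFDerivAt.comp z.2.2.2 (g := hamFun g) (hg.hasFDerivAt_hamFun z) hin
  exact congrArg (fun L : E d →L[ℝ] ℝ => L v) h.fderiv

theorem IsMetric.inner_hamField_p (hg : IsMetric g) (z : Phase d) (v : E d) :
    ⟪(hamField g z).2.2.1, v⟫_ℝ = -fderiv ℝ (hamFun g) z (v, 0, 0, 0) := by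
  rw [hamField, inner_neg_left, inner_gradient]
  have hin : HasFDerivAt (fun x => ((x, z.2) : Phase d))
      ((ContinuousLinearMap.id ℝ (E d)).prod (0 : E d →L[ℝ] E d × E d × E d)) z.1 :=
    (hasFDerivAt_id _).prodMk (hasFDerivAt_const z.2 _)
  have h := HasFDerivAt.comp z.1 (g := hamFun g) (hg.hasFDerivAt_hamFun z) hin
  exact congrArg (fun L : E d →L[ℝ] ℝ => -L v) h.fderiv

theorem IsMetric.inner_hamField_q (hg : IsMetric g) (z : Phase d) (v : E d) :
    ⟪(hamField g z).2.2.2, v⟫_ℝ = -fderiv ℝ (hamFun g) z (0, v, 0, 0) := by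
  rw [hamField, inner_neg_left, inner_gradient]
  have hin : HasFDerivAt (fun y => ((z.1, y, z.2.2) : Phase d))
      ((0 : E d →L[ℝ] E d).prod ((ContinuousLinearMap.id ℝ (E d)).prod
        (0 : E d →L[ℝ] E d × E d))) z.2.1 :=
    (hasFDerivAt_const z.1 _).prodMk ((hasFDerivAt_id _).prodMk (hasFDerivAt_const z.2.2 _))
  have h := HasFDerivAt.comp z.2.1 (g := hamFun g) (hg.hasFDerivAt_hamFun z) hin
  exact congrArg (fun L : E d →L[ℝ] ℝ => -L v) h.fderiv

theorem IsMetric.fderiv_hamFun (hg : IsMetric g) (z δ : Phase d) :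
    fderiv ℝ (hamFun g) z δ = -⟪(hamField g z).2.2.1, δ.1⟫_ℝ - ⟪(hamField g z).2.2.2, δ.2.1⟫_ℝ
      + ⟪(hamField g z).1, δ.2.2.1⟫_ℝ + ⟪(hamField g z).2.1, δ.2.2.2⟫_ℝ := by
  rw [hg.inner_hamField_x, hg.inner_hamField_y, hg.inner_hamField_p, hg.inner_hamField_q, neg_neg,
    sub_neg_eq_add, ← map_add, ← map_add, ← map_add]
  simp

theorem IsMetric.contDiff_hamField (hg : IsMetric g) : ContDiff ℝ ∞ (hamField g) := by
  have h1 : ContDiff ℝ ∞ (fderiv ℝ (hamFun g)) := hg.contDiff_hamFun.fderiv_right (by simp)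
  have h2 : ∀ δ : Phase d, ContDiff ℝ ∞ fun z => fderiv ℝ (hamFun g) z δ :=
    fun δ => h1.clm_apply contDiff_const
  refine ContDiff.prodMk (f := fun z => (hamField g z).1) (contDiff_of_inner fun v => ?_)
    (ContDiff.prodMk (f := fun z => (hamField g z).2.1) (contDiff_of_inner fun v => ?_)
    (ContDiff.prodMk (f := fun z => (hamField g z).2.2.1) (contDiff_of_inner fun v => ?_)
      (contDiff_of_inner (f := fun z => (hamField g z).2.2.2) fun v => ?_)))
  · simpa only [hg.inner_hamField_x] using h2 _
  · simpa only [hg.inner_hamField_y] using h2 _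
  · simpa only [hg.inner_hamField_p] using (h2 _).neg
  · simpa only [hg.inner_hamField_q] using (h2 _).neg

theorem hamField_fst (z : Phase d) : (hamField g z).1 = -coG g z.1 z.2.1 := by
  refine ext_inner_right ℝ fun v => ?_
  rw [hamField, inner_gradient]
  have h : HasFDerivAt (fun p => ham g z.1 z.2.1 p z.2.2.2) _ z.2.2.1 :=
    (((hasFDerivAt_const (coG g z.1 z.2.1) z.2.2.1).inner ℝ (hasFDerivAt_id z.2.2.1)).const_sub
      _).add_const _
  rw [h.fderiv]
  simp

theorem IsMetric.hamField_snd (hg : IsMetric g) (z : Phase d) :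
    (hamField g z).2.1 = g z.1 z.2.2.2 + (1 / 2 : ℝ) • force g z.1 z.2.1 := by
  refine ext_inner_right ℝ fun v => ?_
  rw [hamField, inner_gradient]
  have h : HasFDerivAt (fun q => ham g z.1 z.2.1 z.2.2.1 q) _ z.2.2.2 :=
    ((((((g z.1).hasFDerivAt (x := z.2.2.2)).inner ℝ (hasFDerivAt_id z.2.2.2)).const_mul
      (1 / 2 : ℝ)).sub_const _).add (((hasFDerivAt_const (force g z.1 z.2.1) z.2.2.2).inner ℝ
      (hasFDerivAt_id z.2.2.2)).const_mul (1 / 2 : ℝ)))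
  rw [h.fderiv]
  simp [inner_add_left, inner_smul_left]
  rw [hg.symm, real_inner_comm]
  ring

/-- The integrand of the action. -/
def lagrangian (g : E d → E d →L[ℝ] E d) (z : Phase d) : ℝ :=
  ⟪z.2.2.1, (hamField g z).1⟫_ℝ + ⟪z.2.2.2, (hamField g z).2.1⟫_ℝ - hamFun g z

theorem IsMetric.contDiff_lagrangian (hg : IsMetric g) : ContDiff ℝ ∞ (lagrangian g) := by
  have h1 := hg.contDiff_hamField
  have h2 := hg.contDiff_hamFun
  exact ((contDiff_snd.snd.fst.inner ℝ h1.fst).add (contDiff_snd.snd.snd.inner ℝ h1.snd.fst)).sub h2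

/-- The `δp`, `δq` terms of `d(p ẋ + q ẏ)` cancel against those of `dH`. Along a variation of a
characteristic the rest is the time derivative of `p·δx + q·δy`. -/
theorem IsMetric.fderiv_lagrangian (hg : IsMetric g) (z δ : Phase d) :
    fderiv ℝ (lagrangian g) z δ =
      ⟪(hamField g z).2.2.1, δ.1⟫_ℝ + ⟪z.2.2.1, (fderiv ℝ (hamField g) z δ).1⟫_ℝ +
      (⟪(hamField g z).2.2.2, δ.2.1⟫_ℝ + ⟪z.2.2.2, (fderiv ℝ (hamField g) z δ).2.1⟫_ℝ) := by
  have hV : HasFDerivAt (hamField g) (fderiv ℝ (hamField g) z) z :=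
    (hg.contDiff_hamField.differentiable (by simp) z).hasFDerivAt
  have h : HasFDerivAt (lagrangian g) _ z :=
    ((hasFDerivAt_snd.snd.fst.inner ℝ hV.fst).add (hasFDerivAt_snd.snd.snd.inner ℝ hV.snd.fst)).sub
      (hg.hasFDerivAt_hamFun z)
  rw [h.fderiv]
  simp [hg.fderiv_hamFun z δ]
  rw [real_inner_comm (hamField g z).1, real_inner_comm (hamField g z).2.1]
  ring

end Hamiltonian

/-! ### Characteristics and their dilations -/

section Characteristics

variable {d : ℕ} {g : E d → E d →L[ℝ] E d} {t : ℝ} {x₀ y₀ : E d} {ζ : E d × E d}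
  {γ : ℝ → Phase d}

theorem isCharacteristic_iff : IsCharacteristic g t x₀ y₀ ζ γ ↔
    IsSolution (hamField g) t (x₀, y₀, ζ) γ :=
  ⟨fun h => ⟨h.init, h.ode⟩, fun h => ⟨h.init, h.ode⟩⟩

theorem IsMetric.characteristic_eqOn (hg : IsMetric g) {γ' : ℝ → Phase d}
    (h : IsCharacteristic g t x₀ y₀ ζ γ) (h' : IsCharacteristic g t x₀ y₀ ζ γ') :
    Set.EqOn γ γ' (Set.Icc 0 t) :=
  (isCharacteristic_iff.1 h).eqOn (hg.contDiff_hamField.of_le (by simp)) (isCharacteristic_iff.1 h')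

theorem IsCharacteristic.mono (h : IsCharacteristic g t x₀ y₀ ζ γ) {s : ℝ} (hs : s ≤ t) :
    IsCharacteristic g s x₀ y₀ ζ γ :=
  isCharacteristic_iff.2 ((isCharacteristic_iff.1 h).mono hs)

theorem IsMetric.endpoint_eq (hg : IsMetric g) (ht : 0 ≤ t)
    (h : IsCharacteristic g t x₀ y₀ ζ γ) : endpoint g t x₀ y₀ ζ = ((γ t).1, (γ t).2.1) := by
  have hex : ∃ γ, IsCharacteristic g t x₀ y₀ ζ γ := ⟨γ, h⟩
  rw [endpoint, dif_pos hex,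
    hg.characteristic_eqOn (Classical.choose_spec hex) h ⟨ht, le_rfl⟩]

/-- The dilation `(x, y, p, q) ↦ (x, t y, t³ p, t² q)` of phase space. -/
def dil (t : ℝ) : Phase d →L[ℝ] Phase d :=
  (ContinuousLinearMap.id ℝ (E d)).prodMap ((t • ContinuousLinearMap.id ℝ (E d)).prodMap
    ((t ^ 3 • ContinuousLinearMap.id ℝ (E d)).prodMap (t ^ 2 • ContinuousLinearMap.id ℝ (E d))))

theorem dil_apply (t : ℝ) (z : Phase d) :
    dil t z = (z.1, t • z.2.1, t ^ 3 • z.2.2.1, t ^ 2 • z.2.2.2) := rfl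

theorem dil_dil (s t : ℝ) (z : Phase d) : dil s (dil t z) = dil (s * t) z := by
  simp only [dil_apply, smul_smul, mul_pow]

theorem dil_one (z : Phase d) : dil 1 z = z := by
  simp [dil_apply]

theorem force_smul (t : ℝ) (hg : IsMetric g) (x y : E d) :
    force g x (t • y) = t ^ 2 • force g x y := by
  refine ext_inner_right ℝ fun v => ?_
  rw [hg.inner_force, inner_smul_left, hg.inner_force]
  simp only [map_smul, inner_smul_left, inner_smul_right, conj_trivial]
  ring

/-- The source of the scaling: the three terms have weights `2+2`, `1+3` and `2+2`, since the force
is quadratic in `y`. -/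
theorem IsMetric.hamFun_dil (hg : IsMetric g) (t : ℝ) (z : Phase d) :
    hamFun g (dil t z) = t ^ 4 * hamFun g z := by
  simp only [hamFun, ham, dil_apply, force_smul t hg, map_smul, inner_smul_left, inner_smul_right,
    conj_trivial]
  ring

theorem IsMetric.fderiv_hamFun_dil (hg : IsMetric g) (t : ℝ) (z δ : Phase d) :
    fderiv ℝ (hamFun g) (dil t z) (dil t δ) = t ^ 4 * fderiv ℝ (hamFun g) z δ := by
  have h1 : HasFDerivAt (fun z => hamFun g (dil t z)) _ z :=
    HasFDerivAt.comp z (g := hamFun g) (hg.hasFDerivAt_hamFun (dil t z)) (dil t).hasFDerivAt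
  simp_rw [hg.hamFun_dil] at h1
  have h2 := (hg.hasFDerivAt_hamFun z).const_mul (t ^ 4)
  exact DFunLike.congr_fun (h1.unique h2) δ

theorem IsMetric.hamField_dil (hg : IsMetric g) (ht : t ≠ 0) (z : Phase d) :
    hamField g (dil t z) = t • dil t (hamField g z) := by
  -- Test vectors are divided by their own weight beforehand, so that the dilation returns `v`. Each
  -- component of the field then scales by `t` times its own weight, because conjugate weights sum
  -- to 3 and `H` has weight 4.
  have key := hg.fderiv_hamFun_dil t z
  rw [dil_apply t (hamField g z)]
  refine Prod.ext ?_ (Prod.ext ?_ (Prod.ext ?_ ?_)) <;> refine ext_inner_right ℝ fun v => ?_ <;>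
    simp only [Prod.smul_fst, Prod.smul_snd, inner_smul_left, conj_trivial, hg.inner_hamField_x,
      hg.inner_hamField_y, hg.inner_hamField_p, hg.inner_hamField_q]
  · have h := key (0, 0, (t ^ 3)⁻¹ • v, 0)
    have h' : dil t (0, 0, (t ^ 3)⁻¹ • v, 0) = (0, 0, v, 0) := by
      simp [dil_apply, ht]
    rw [h', show ((0 : E d), (0 : E d), (t ^ 3)⁻¹ • v, (0 : E d)) = (t ^ 3)⁻¹ • (0, 0, v, 0) by
      simp, map_smul, smul_eq_mul] at h
    rw [h]; field_simp
  · have h := key (0, 0, 0, (t ^ 2)⁻¹ • v)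
    have h' : dil t (0, 0, 0, (t ^ 2)⁻¹ • v) = (0, 0, 0, v) := by
      simp [dil_apply, ht]
    rw [h', show ((0 : E d), (0 : E d), (0 : E d), (t ^ 2)⁻¹ • v) = (t ^ 2)⁻¹ • (0, 0, 0, v) by
      simp, map_smul, smul_eq_mul] at h
    rw [h]; field_simp
  · have h := key (v, 0, 0, 0)
    have h' : dil t (v, 0, 0, 0) = (v, 0, 0, 0) := by simp [dil_apply]
    rw [h'] at h
    rw [h]; ring
  · have h := key (0, t⁻¹ • v, 0, 0)
    have h' : dil t (0, t⁻¹ • v, 0, 0) = (0, v, 0, 0) := by simp [dil_apply, ht]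
    rw [h', show ((0 : E d), t⁻¹ • v, (0 : E d), (0 : E d)) = t⁻¹ • (0, v, 0, 0) by
      simp, map_smul, smul_eq_mul] at h
    rw [h]; field_simp

theorem IsMetric.isSolution_dil (hg : IsMetric g) {l : ℝ} (hl : 0 < l) {z : Phase d}
    (h : IsSolution (hamField g) t z γ) :
    IsSolution (hamField g) (t / l) (dil l z) (fun s => dil l (γ (l * s))) := by
  refine ⟨by simp [h.init], fun s hs => ?_⟩
  have hmaps : Set.MapsTo (fun s => l * s) (Set.Icc 0 (t / l)) (Set.Icc 0 t) := fun r hr =>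
    ⟨mul_nonneg hl.le hr.1, (le_div_iff₀' hl).1 hr.2⟩
  have h1 := (h.ode (l * s) (hmaps hs)).scomp s
    (HasDerivAt.hasDerivWithinAt ((hasDerivAt_id s).const_mul l)) hmaps
  have h2 := (dil (d := d) l).hasFDerivAt.comp_hasDerivWithinAt s h1
  refine h2.congr_deriv ?_
  rw [hg.hamField_dil (ne_of_gt hl)]
  simp

/-- Dilation of momenta. -/
def dilMom (t : ℝ) (ζ : E d × E d) : E d × E d := (t ^ 3 • ζ.1, t ^ 2 • ζ.2)

theorem IsMetric.isCharacteristic_dil (hg : IsMetric g) (ht : 0 < t)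
    (h : IsCharacteristic g t x₀ y₀ ζ γ) :
    IsCharacteristic g 1 x₀ (t • y₀) (dilMom t ζ) (fun s => dil t (γ (t * s))) := by
  have := hg.isSolution_dil ht (isCharacteristic_iff.1 h)
  rw [div_self ht.ne'] at this
  exact isCharacteristic_iff.2 this

/-- The converse dilates back by `t⁻¹`, so no characteristic is lost when passing to time 1. -/
theorem IsMetric.exists_characteristic_iff (hg : IsMetric g) (ht : 0 < t) :
    (∃ γ, IsCharacteristic g t x₀ y₀ ζ γ) ↔
      ∃ γ, IsCharacteristic g 1 x₀ (t • y₀) (dilMom t ζ) γ := by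
  refine ⟨fun ⟨γ, h⟩ => ⟨_, hg.isCharacteristic_dil ht h⟩, fun ⟨γ, h⟩ => ?_⟩
  have := hg.isSolution_dil (inv_pos.2 ht) (isCharacteristic_iff.1 h)
  refine ⟨fun s => dil t⁻¹ (γ (t⁻¹ * s)), isCharacteristic_iff.2 ?_⟩
  rw [one_div, inv_inv] at this
  convert this using 1
  change _ = dil t⁻¹ (dil t (x₀, y₀, ζ))
  rw [dil_dil, inv_mul_cancel₀ ht.ne', dil_one]

theorem IsMetric.mem_momenta_iff (hg : IsMetric g) (c : ℝ≥0∞) (ht : 0 < t) :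
    ζ ∈ momenta g c t x₀ y₀ ↔ dilMom t ζ ∈ momenta g c 1 x₀ (t • y₀) := by
  simp only [momenta, Set.mem_ofPred_eq, hg.exists_characteristic_iff ht, dilMom, norm_smul,
    norm_pow, Real.norm_of_nonneg ht.le, one_pow, one_mul]

theorem IsMetric.endpoint_dil (hg : IsMetric g) (ht : 0 < t) :
    endpoint g t x₀ y₀ ζ = ((endpoint g 1 x₀ (t • y₀) (dilMom t ζ)).1,
      t⁻¹ • (endpoint g 1 x₀ (t • y₀) (dilMom t ζ)).2) := by
  by_cases hex : ∃ γ, IsCharacteristic g t x₀ y₀ ζ γ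
  · obtain ⟨γ, h⟩ := hex
    rw [hg.endpoint_eq ht.le h, hg.endpoint_eq zero_le_one (hg.isCharacteristic_dil ht h)]
    simp [dil_apply, smul_smul, ht.ne']
  -- Without a characteristic both endpoint maps take the default value 0, which the scaling
  -- preserves. The identity therefore holds for all momenta and may be differentiated.
  · have hex' := mt (hg.exists_characteristic_iff ht).2 hex
    rw [endpoint, endpoint, dif_neg hex, dif_neg hex']
    simp [Prod.zero_eq_mk]

theorem momenta_mono {c : ℝ≥0∞} {s : ℝ} (hs : 0 ≤ s) (hst : s ≤ t)
    (h : ζ ∈ momenta g c t x₀ y₀) : ζ ∈ momenta g c s x₀ y₀ := by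
  obtain ⟨h1, h2, γ, h3⟩ := h
  exact ⟨(ENNReal.ofReal_le_ofReal (by gcongr)).trans_lt h1,
    (ENNReal.ofReal_le_ofReal (by gcongr)).trans_lt h2, γ, h3.mono hst⟩

theorem IsMetric.eventually_characteristic (hg : IsMetric g) (ht : 0 ≤ t)
    (h : IsCharacteristic g t x₀ y₀ ζ γ) :
    ∀ᶠ w : E d × E d × E d in 𝓝 (y₀, ζ), ∃ γ, IsCharacteristic g t x₀ w.1 w.2 γ := by
  obtain ⟨Γ, D, hΓ, -⟩ := exists_isFlowNear ht hg.contDiff_hamField (isCharacteristic_iff.1 h)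
  have hc : Continuous fun w : E d × E d × E d => ((x₀, w) : Phase d) := by fun_prop
  filter_upwards [(hc.tendsto (y₀, ζ)).eventually hΓ.sol] with w hw
  exact ⟨_, isCharacteristic_iff.2 hw⟩

theorem IsMetric.contDiffAt_endpoint (hg : IsMetric g) (ht : 0 ≤ t)
    (h : IsCharacteristic g t x₀ y₀ ζ γ) :
    ContDiffAt ℝ ∞ (fun w : E d × E d × E d => endpoint g t x₀ w.1 w.2) (y₀, ζ) := by
  obtain ⟨Γ, D, hΓ, -⟩ := exists_isFlowNear ht hg.contDiff_hamField (isCharacteristic_iff.1 h)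
  have hc : ContDiff ℝ ∞ fun w : E d × E d × E d => ((x₀, w) : Phase d) :=
    contDiff_const.prodMk contDiff_id
  have h1 : ContDiffAt ℝ ∞ (fun w : E d × E d × E d => Γ (x₀, w) t) (y₀, ζ) :=
    ContDiffAt.comp (y₀, ζ) (g := fun z => Γ z t) (hΓ.smooth t ⟨ht, le_rfl⟩) hc.contDiffAt
  refine (h1.fst.prodMk h1.snd.fst).congr_of_eventuallyEq ?_
  filter_upwards [(hc.continuous.tendsto (y₀, ζ)).eventually hΓ.sol] with w hw
  exact hg.endpoint_eq ht (isCharacteristic_iff.2 hw)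

theorem IsMetric.eventually_mem_momenta (hg : IsMetric g) (ht : 0 ≤ t) {c : ℝ≥0∞}
    (h : ζ ∈ momenta g c t x₀ y₀) :
    ∀ᶠ w : E d × E d × E d in 𝓝 (y₀, ζ), w.2 ∈ momenta g c t x₀ w.1 := by
  obtain ⟨h1, h2, γ, h3⟩ := h
  have hc1 : Continuous fun w : E d × E d × E d => ENNReal.ofReal (t ^ 3 * ‖w.2.1‖) :=
    ENNReal.continuous_ofReal.comp (by fun_prop)
  have hc2 : Continuous fun w : E d × E d × E d => ENNReal.ofReal (t ^ 2 * ‖w.2.2‖) :=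
    ENNReal.continuous_ofReal.comp (by fun_prop)
  filter_upwards [hg.eventually_characteristic ht h3,
    (hc1.tendsto (y₀, ζ)).eventually (gt_mem_nhds h1),
    (hc2.tendsto (y₀, ζ)).eventually (gt_mem_nhds h2)] with w hw hw1 hw2
  exact ⟨hw1, hw2, hw⟩

theorem IsMetric.hasFDerivAt_endpoint (hg : IsMetric g) (ht : 0 ≤ t)
    (h : IsCharacteristic g t x₀ y₀ ζ γ) :
    HasFDerivAt (endpoint g t x₀ y₀) (fderiv ℝ (endpoint g t x₀ y₀) ζ) ζ := by
  have hc : ContDiff ℝ ∞ fun ζ : E d × E d => (y₀, ζ) := contDiff_const.prodMk contDiff_id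
  have h1 : ContDiffAt ℝ ∞ (endpoint g t x₀ y₀) ζ :=
    ContDiffAt.comp ζ (g := fun w : E d × E d × E d => endpoint g t x₀ w.1 w.2)
      (hg.contDiffAt_endpoint ht h) hc.contDiffAt
  exact (h1.differentiableAt (by simp)).hasFDerivAt

theorem det_prodMap_smul (a b : ℝ) :
    ((a • ContinuousLinearMap.id ℝ (E d)).prodMap
      (b • ContinuousLinearMap.id ℝ (E d))).det = a ^ d * b ^ d := by
  rw [ContinuousLinearMap.det]
  have : (((a • ContinuousLinearMap.id ℝ (E d)).prodMap (b • ContinuousLinearMap.id ℝ (E d)) :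
      E d × E d →L[ℝ] E d × E d) : E d × E d →ₗ[ℝ] E d × E d) =
      (a • LinearMap.id).prodMap (b • LinearMap.id) := by ext <;> rfl
  rw [this, LinearMap.det_prodMap]
  simp

/-- Dilating the momenta contributes `t^{3d} t^{2d}`, undoing the dilation of the endpoint
contributes `t^{-d}`. -/
theorem IsMetric.jac_dil (hg : IsMetric g) (ht : 0 < t) (h : IsCharacteristic g t x₀ y₀ ζ γ) :
    jac g t x₀ y₀ ζ = t ^ (4 * d) * jac g 1 x₀ (t • y₀) (dilMom t ζ) := by
  set A : E d × E d →L[ℝ] E d × E d := (t ^ 3 • ContinuousLinearMap.id ℝ (E d)).prodMap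
    (t ^ 2 • ContinuousLinearMap.id ℝ (E d)) with hA
  set B : E d × E d →L[ℝ] E d × E d := ((1 : ℝ) • ContinuousLinearMap.id ℝ (E d)).prodMap
    (t⁻¹ • ContinuousLinearMap.id ℝ (E d)) with hB
  have h1 : endpoint g t x₀ y₀ = fun ζ => B (endpoint g 1 x₀ (t • y₀) (A ζ)) := by
    funext ζ
    rw [hg.endpoint_dil ht]
    simp [hB, hA, dilMom, Prod.map]
  have h2 : HasFDerivAt (endpoint g t x₀ y₀)
      (B.comp ((fderiv ℝ (endpoint g 1 x₀ (t • y₀)) (dilMom t ζ)).comp A)) ζ := by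
    rw [h1]
    exact B.hasFDerivAt.comp ζ (HasFDerivAt.comp ζ (f := A)
      (hg.hasFDerivAt_endpoint zero_le_one (hg.isCharacteristic_dil ht h)) A.hasFDerivAt)
  have hdA : LinearMap.det (A : E d × E d →ₗ[ℝ] E d × E d) = (t ^ 3) ^ d * (t ^ 2) ^ d :=
    det_prodMap_smul _ _
  have hdB : LinearMap.det (B : E d × E d →ₗ[ℝ] E d × E d) = 1 ^ d * t⁻¹ ^ d :=
    det_prodMap_smul _ _
  rw [jac, jac, h2.fderiv]
  simp only [ContinuousLinearMap.det, ContinuousLinearMap.toLinearMap_comp, LinearMap.det_comp]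
  rw [hdA, hdB]
  have : t ^ (4 * d) * t ^ d = (t ^ 3) ^ d * (t ^ 2) ^ d := by ring
  rw [one_pow, one_mul, inv_pow]
  field_simp
  rw [← pow_mul, ← pow_mul] at *
  linear_combination (LinearMap.det
    (fderiv ℝ (endpoint g 1 x₀ (t • y₀)) (dilMom t ζ) : E d × E d →ₗ[ℝ] E d × E d)) * -this

end Characteristics

/-! ### The inverse of the endpoint map -/

/-- Near each image point the smooth local inverse takes values in the open set `M`, and injectivity
forces the global inverse to agree with it. -/
theorem isOpen_image_and_contDiffAt_invFunOn {F F₂ : Type*} [NormedAddCommGroup F]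
    [NormedSpace ℝ F] [CompleteSpace F] [NormedAddCommGroup F₂] [NormedSpace ℝ F₂] {f : F → F₂}
    {M : Set F} [Nonempty F] (hM : IsOpen M) (hinj : Set.InjOn f M)
    (hf : ∀ w ∈ M, ContDiffAt ℝ ∞ f w)
    (hf' : ∀ w ∈ M, ∃ e : F ≃L[ℝ] F₂, HasFDerivAt f (e : F →L[ℝ] F₂) w) :
    IsOpen (f '' M) ∧ ∀ o ∈ f '' M, ContDiffAt ℝ ∞ (Function.invFunOn f M) o := by
  have key : ∀ w ∈ M, f '' M ∈ 𝓝 (f w) ∧ ContDiffAt ℝ ∞ (Function.invFunOn f M) (f w) := by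
    intro w hw
    obtain ⟨e, he⟩ := hf' w hw
    have hc := hf w hw
    have hn : (∞ : ℕ∞ω) ≠ 0 := by simp
    have hloc := hc.to_localInverse he hn
    have h0 := hc.localInverse_apply_image he hn
    have hr := (hc.hasStrictFDerivAt' he hn).eventually_right_inverse
    have hmem : ∀ᶠ o in 𝓝 (f w), hc.localInverse he hn o ∈ M :=
      hloc.continuousAt.eventually (by rw [h0]; exact hM.mem_nhds hw)
    constructor
    · filter_upwards [hr, hmem] with o ho1 ho2
      exact ⟨_, ho2, ho1⟩
    · refine hloc.congr_of_eventuallyEq ?_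
      filter_upwards [hr, hmem] with o ho1 ho2
      have hex : ∃ a ∈ M, f a = o := ⟨_, ho2, ho1⟩
      exact hinj (Function.invFunOn_mem hex) ho2 ((Function.invFunOn_eq hex).trans ho1.symm)
  refine ⟨isOpen_iff_mem_nhds.2 ?_, ?_⟩
  · rintro _ ⟨w, hw, rfl⟩
    exact (key w hw).1
  · rintro _ ⟨w, hw, rfl⟩
    exact (key w hw).2

section Endpoint

variable {d : ℕ} {g : E d → E d →L[ℝ] E d} {T : ℝ} {b c r : ℝ≥0∞} {x₀ : E d}

/-- Starting points `y₀` with `|y₀| < b` and initial momenta of characteristics on `[0, 1]`. -/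
def unitMomenta (g : E d → E d →L[ℝ] E d) (b c : ℝ≥0∞) (x₀ : E d) : Set (E d × E d × E d) :=
  {w | ENNReal.ofReal ‖w.1‖ < b ∧ w.2 ∈ momenta g c 1 x₀ w.1}

/-- The map `(y₀, ζ) ↦ (y₀, (X, Y)(1, x₀, y₀, ζ))`. -/
def unitEndpoint (g : E d → E d →L[ℝ] E d) (x₀ : E d) (w : E d × E d × E d) :
    E d × E d × E d :=
  (w.1, endpoint g 1 x₀ w.1 w.2)

theorem dilMom_dilMom_inv {t : ℝ} (ht : t ≠ 0) (ζ : E d × E d) :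
    dilMom t (dilMom t⁻¹ ζ) = ζ := by
  simp [dilMom, smul_smul, ht]

theorem IsMetric.isOpen_unitMomenta (hg : IsMetric g) : IsOpen (unitMomenta g b c x₀) := by
  rw [isOpen_iff_mem_nhds]
  rintro ⟨η, ζ⟩ ⟨h1, h2⟩
  have hc : Continuous fun w : E d × E d × E d => ENNReal.ofReal ‖w.1‖ :=
    ENNReal.continuous_ofReal.comp (by fun_prop)
  filter_upwards [(hc.tendsto (η, ζ)).eventually (gt_mem_nhds h1),
    hg.eventually_mem_momenta zero_le_one h2] with w hw1 hw2
  exact ⟨hw1, hw2⟩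

theorem unitMomenta_dil (hg : IsMetric g) {t : ℝ} (ht : 0 < t) {w : E d × E d × E d}
    (hw : w ∈ unitMomenta g b c x₀) :
    ENNReal.ofReal (t * ‖t⁻¹ • w.1‖) < b ∧
      dilMom t⁻¹ w.2 ∈ momenta g c t x₀ (t⁻¹ • w.1) := by
  constructor
  · rw [norm_smul, norm_inv, Real.norm_of_nonneg ht.le, mul_inv_cancel_left₀ ht.ne']
    exact hw.1
  · rw [hg.mem_momenta_iff c ht, dilMom_dilMom_inv ht.ne', smul_inv_smul₀ ht.ne']
    exact hw.2

theorem endpoint_dil_inv (hg : IsMetric g) {t : ℝ} (ht : 0 < t) (w : E d × E d × E d) :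
    endpoint g t x₀ (t⁻¹ • w.1) (dilMom t⁻¹ w.2) =
      ((endpoint g 1 x₀ w.1 w.2).1, t⁻¹ • (endpoint g 1 x₀ w.1 w.2).2) := by
  rw [hg.endpoint_dil ht, dilMom_dilMom_inv ht.ne', smul_inv_smul₀ ht.ne']

theorem UniquelySolvable.injOn_unitEndpoint (h : UniquelySolvable g T b c r x₀)
    (hg : IsMetric g) (hT : 0 < T) :
    Set.InjOn (unitEndpoint g x₀) (unitMomenta g b c x₀) := by
  rintro ⟨η, ζ⟩ hw ⟨η', ζ'⟩ hw' heq
  obtain ⟨h1, h2⟩ := Prod.mk.inj heq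
  obtain rfl : η = η' := h1
  -- Any single time in `(0, T)` would do: dilation transfers the hypothesis from there to time 1,
  -- even when `T ≤ 1`.
  have ht : T / 2 ∈ Set.Ioo 0 T := ⟨by linarith, by linarith⟩
  obtain ⟨hb, hm⟩ := unitMomenta_dil hg ht.1 hw
  obtain ⟨-, hm'⟩ := unitMomenta_dil hg ht.1 hw'
  have h3 := h.inj _ ht _ hb hm hm' (by
    rw [endpoint_dil_inv hg ht.1 (η, ζ), endpoint_dil_inv hg ht.1 (η, ζ')]
    simp only at h2 ⊢
    rw [h2])
  have h4 := congrArg (dilMom (T / 2)) h3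
  rw [dilMom_dilMom_inv ht.1.ne', dilMom_dilMom_inv ht.1.ne'] at h4
  exact Prod.ext rfl h4

theorem UniquelySolvable.unit_jac_ne_zero (h : UniquelySolvable g T b c r x₀)
    (hg : IsMetric g) (hT : 0 < T) {w : E d × E d × E d} (hw : w ∈ unitMomenta g b c x₀) :
    jac g 1 x₀ w.1 w.2 ≠ 0 := by
  have ht : T / 2 ∈ Set.Ioo 0 T := ⟨by linarith, by linarith⟩
  obtain ⟨hb, hm⟩ := unitMomenta_dil hg ht.1 hw
  obtain ⟨γ, hγ⟩ := hm.2.2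
  have h1 := h.jac_ne _ ht _ hb _ hm
  rw [hg.jac_dil ht.1 hγ, dilMom_dilMom_inv ht.1.ne', smul_inv_smul₀ ht.1.ne'] at h1
  exact right_ne_zero_of_mul h1

theorem UniquelySolvable.polydisk_subset (h : UniquelySolvable g T b c r x₀)
    (hg : IsMetric g) (hT : 0 < T) {η₀ x η : E d} (hb : ENNReal.ofReal ‖η₀‖ < b)
    (hx : ENNReal.ofReal ‖x - x₀‖ < r) (hη : ENNReal.ofReal ‖η - η₀‖ < r) :
    (η₀, x, η) ∈ unitEndpoint g x₀ '' unitMomenta g b c x₀ := by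
  have ht : T / 2 ∈ Set.Ioo 0 T := ⟨by linarith, by linarith⟩
  have h1 : (x, (T / 2)⁻¹ • η) ∈ polydisk r (T / 2) x₀ ((T / 2)⁻¹ • η₀) := by
    refine ⟨hx, ?_⟩
    rw [← smul_sub, norm_smul, norm_inv, Real.norm_of_nonneg ht.1.le,
      mul_inv_cancel_left₀ ht.1.ne']
    exact hη
  obtain ⟨ζ, hζ, hζe⟩ := h.surj _ ht _ (by
    rw [norm_smul, norm_inv, Real.norm_of_nonneg ht.1.le, mul_inv_cancel_left₀ ht.1.ne']
    exact hb) h1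
  rw [hg.mem_momenta_iff c ht.1, smul_inv_smul₀ ht.1.ne'] at hζ
  rw [hg.endpoint_dil ht.1, smul_inv_smul₀ ht.1.ne'] at hζe
  obtain ⟨he1, he2⟩ := Prod.mk.inj hζe
  refine ⟨(η₀, dilMom (T / 2) ζ), ⟨hb, hζ⟩, ?_⟩
  refine Prod.ext rfl (Prod.ext he1 ?_)
  exact smul_right_injective _ (inv_ne_zero ht.1.ne') he2

theorem IsMetric.contDiffAt_unitEndpoint (hg : IsMetric g) {w : E d × E d × E d}
    (hw : w ∈ unitMomenta g b c x₀) : ContDiffAt ℝ ∞ (unitEndpoint g x₀) w := by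
  obtain ⟨γ, hγ⟩ := hw.2.2.2
  exact contDiffAt_fst.prodMk (hg.contDiffAt_endpoint zero_le_one hγ)

/-- With the starting point carried along as a parameter the derivative is block triangular, with
identity block and a block of determinant `J ≠ 0`. -/
theorem UniquelySolvable.exists_equiv (h : UniquelySolvable g T b c r x₀)
    (hg : IsMetric g) (hT : 0 < T) {w : E d × E d × E d} (hw : w ∈ unitMomenta g b c x₀) :
    ∃ e : (E d × E d × E d) ≃L[ℝ] (E d × E d × E d),
      HasFDerivAt (unitEndpoint g x₀) (e : E d × E d × E d →L[ℝ] E d × E d × E d) w := by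
  obtain ⟨γ, hγ⟩ := hw.2.2.2
  set f := fun w : E d × E d × E d => endpoint g 1 x₀ w.1 w.2
  have hf : HasFDerivAt f (fderiv ℝ f w) w :=
    ((hg.contDiffAt_endpoint zero_le_one hγ).differentiableAt (by simp)).hasFDerivAt
  have hL : HasFDerivAt (unitEndpoint g x₀)
      ((ContinuousLinearMap.fst ℝ (E d) (E d × E d)).prod (fderiv ℝ f w)) w :=
    hasFDerivAt_fst.prodMk hf
  set L := (ContinuousLinearMap.fst ℝ (E d) (E d × E d)).prod (fderiv ℝ f w)
  have hpart : HasFDerivAt (endpoint g 1 x₀ w.1)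
      ((fderiv ℝ f w).comp (ContinuousLinearMap.inr ℝ (E d) (E d × E d))) w.2 :=
    HasFDerivAt.comp w.2 (g := f) (f := fun ζ => (w.1, ζ)) hf (hasFDerivAt_prodMk_right w.1 w.2)
  have hjac := h.unit_jac_ne_zero hg hT hw
  rw [jac, hpart.fderiv] at hjac
  have hinj : Function.Injective (L : E d × E d × E d →ₗ[ℝ] E d × E d × E d) := by
    rw [← LinearMap.ker_eq_bot, LinearMap.ker_eq_bot']
    rintro ⟨δ, ε⟩ hδ
    obtain ⟨h1, h2⟩ := Prod.mk.inj (show (δ, fderiv ℝ f w (δ, ε)) = (0, 0) from hδ)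
    subst h1
    have h3 := (ContinuousLinearMap.toContinuousLinearEquivOfDetNeZero _ hjac).injective
      (a₁ := ε) (a₂ := 0) (by rw [map_zero]; exact h2)
    rw [h3]; rfl
  exact ⟨(LinearEquiv.ofInjectiveEndo _ hinj).toContinuousLinearEquiv, hL⟩

/-- The end points of the characteristics on `[0, 1]`, together with their starting points. -/
def unitReached (g : E d → E d →L[ℝ] E d) (b c : ℝ≥0∞) (x₀ : E d) : Set (E d × E d × E d) :=
  unitEndpoint g x₀ '' unitMomenta g b c x₀

/-- The initial data of the characteristic on `[0, 1]` with given end points. -/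
def unitInverse (g : E d → E d →L[ℝ] E d) (b c : ℝ≥0∞) (x₀ : E d) :
    E d × E d × E d → E d × E d × E d :=
  Function.invFunOn (unitEndpoint g x₀) (unitMomenta g b c x₀)

theorem UniquelySolvable.isOpen_unitReached (h : UniquelySolvable g T b c r x₀)
    (hg : IsMetric g) (hT : 0 < T) : IsOpen (unitReached g b c x₀) :=
  (isOpen_image_and_contDiffAt_invFunOn hg.isOpen_unitMomenta (h.injOn_unitEndpoint hg hT)
    (fun _ hw => hg.contDiffAt_unitEndpoint hw) (fun _ hw => h.exists_equiv hg hT hw)).1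

theorem UniquelySolvable.contDiffAt_unitInverse (h : UniquelySolvable g T b c r x₀)
    (hg : IsMetric g) (hT : 0 < T) {o : E d × E d × E d} (ho : o ∈ unitReached g b c x₀) :
    ContDiffAt ℝ ∞ (unitInverse g b c x₀) o :=
  (isOpen_image_and_contDiffAt_invFunOn hg.isOpen_unitMomenta (h.injOn_unitEndpoint hg hT)
    (fun _ hw => hg.contDiffAt_unitEndpoint hw) (fun _ hw => h.exists_equiv hg hT hw)).2 o ho

theorem unitInverse_mem {o : E d × E d × E d} (ho : o ∈ unitReached g b c x₀) :
    unitInverse g b c x₀ o ∈ unitMomenta g b c x₀ :=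
  Function.invFunOn_mem ho

theorem UniquelySolvable.unitInverse_unitEndpoint (h : UniquelySolvable g T b c r x₀)
    (hg : IsMetric g) (hT : 0 < T) {w : E d × E d × E d} (hw : w ∈ unitMomenta g b c x₀) :
    unitInverse g b c x₀ (unitEndpoint g x₀ w) = w :=
  (h.injOn_unitEndpoint hg hT).leftInvOn_invFunOn hw

/-- The Jacobian of the characteristics on `[0, 1]`. -/
def unitJac (g : E d → E d →L[ℝ] E d) (x₀ : E d) (w : E d × E d × E d) : ℝ :=
  jac g 1 x₀ w.1 w.2

/-- Here `w` is both parameter and base point of the partial derivative, so joint smoothness of the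
endpoint map is needed. -/
theorem IsMetric.contDiffAt_unitJac (hg : IsMetric g) {w : E d × E d × E d}
    (hw : w ∈ unitMomenta g b c x₀) : ContDiffAt ℝ ∞ (unitJac g x₀) w := by
  obtain ⟨γ, hγ⟩ := hw.2.2.2
  have h1 : ContDiffAt ℝ ∞ (Function.uncurry fun (w : E d × E d × E d) (ζ : E d × E d) =>
      endpoint g 1 x₀ w.1 ζ) (w, w.2) :=
    ContDiffAt.comp (w, w.2) (g := fun w : E d × E d × E d => endpoint g 1 x₀ w.1 w.2)
      (f := fun v : (E d × E d × E d) × (E d × E d) => (v.1.1, v.2))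
      (hg.contDiffAt_endpoint zero_le_one hγ)
      (contDiff_fst.fst.prodMk contDiff_snd).contDiffAt
  have h2 : ContDiffAt ℝ ∞ (fun w : E d × E d × E d =>
      fderiv ℝ (endpoint g 1 x₀ w.1) w.2) w :=
    ContDiffAt.fderiv h1 contDiffAt_snd (by simp)
  exact ContDiffAt.comp w (g := fun M : E d × E d →L[ℝ] E d × E d => M.det)
    contDiff_clm_det.contDiffAt h2

/-- This makes the reached set a preimage of one open set at time 1 under `(t, x, y) ↦ (t y₀, x, t
y)`. -/
theorem mem_reached_iff (hg : IsMetric g) {t : ℝ} {x y y₀ : E d} (ht : t ∈ Set.Ioo 0 T)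
    (hb : ENNReal.ofReal (t * ‖y₀‖) < b) :
    (t, x, y) ∈ reached g T c x₀ y₀ ↔ (t • y₀, x, t • y) ∈ unitReached g b c x₀ := by
  constructor
  · rintro ⟨-, ζ, hζ, he⟩
    rw [hg.mem_momenta_iff c ht.1] at hζ
    rw [hg.endpoint_dil ht.1] at he
    obtain ⟨he1, he2⟩ := Prod.mk.inj he
    refine ⟨(t • y₀, dilMom t ζ), ⟨?_, hζ⟩, Prod.ext rfl (Prod.ext he1 ?_)⟩
    · rwa [norm_smul, Real.norm_of_nonneg ht.1.le]
    · rw [← he2, smul_inv_smul₀ ht.1.ne']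
      rfl
  · rintro ⟨⟨η, ζ⟩, hw, he⟩
    obtain ⟨h1, h2⟩ := Prod.mk.inj he
    obtain ⟨h2, h3⟩ := Prod.ext_iff.1 h2
    simp only at h1 h2 h3
    subst h1
    refine ⟨ht, dilMom t⁻¹ ζ, ?_, ?_⟩
    · rw [hg.mem_momenta_iff c ht.1, dilMom_dilMom_inv ht.1.ne']
      exact hw.2
    · rw [hg.endpoint_dil ht.1, dilMom_dilMom_inv ht.1.ne', h2, h3, inv_smul_smul₀ ht.1.ne']

theorem UniquelySolvable.isOpen_reached (h : UniquelySolvable g T b c r x₀) (hg : IsMetric g)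
    {y₀ : E d} (hb : ∀ t ∈ Set.Ioo 0 T, ENNReal.ofReal (t * ‖y₀‖) < b) :
    IsOpen (reached g T c x₀ y₀) := by
  rcases le_or_gt T 0 with hT | hT
  · convert isOpen_empty
    refine Set.eq_empty_of_forall_notMem fun z hz => ?_
    exact absurd (hz.1.1.trans hz.1.2) (not_lt.2 hT)
  have h1 : reached g T c x₀ y₀ = {z | z.1 ∈ Set.Ioo 0 T} ∩
      (fun z : ℝ × E d × E d => (z.1 • y₀, z.2.1, z.1 • z.2.2)) ⁻¹' unitReached g b c x₀ := by
    ext ⟨t, x, y⟩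
    constructor
    · exact fun hz => ⟨hz.1, (mem_reached_iff hg hz.1 (hb t hz.1)).1 hz⟩
    · exact fun hz => (mem_reached_iff hg hz.1 (hb t hz.1)).2 hz.2
  rw [h1]
  exact (isOpen_Ioo.preimage continuous_fst).inter
    ((h.isOpen_unitReached hg hT).preimage (by fun_prop))

end Endpoint

/-! ### The gradient of the two-point function -/

section TwoPoint

variable {d : ℕ} {g : E d → E d →L[ℝ] E d}

/-- A function of `(t, x, y)` as a function on the product space. -/
def packed (u : ℝ → E d → E d → ℝ) (z : ℝ × E d × E d) : ℝ := u z.1 z.2.1 z.2.2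

/-! ### Partial derivatives read off from the total derivative -/

section Partial

variable {u : ℝ → E d → E d → ℝ} {t : ℝ} {x y : E d}

theorem derivT_eq (hu : DifferentiableAt ℝ (packed u) (t, x, y)) :
    derivT u t x y = fderiv ℝ (packed u) (t, x, y) (1, 0, 0) := by
  have hin : HasDerivAt (fun s : ℝ => (s, x, y)) (1, 0, 0) t :=
    (hasDerivAt_id t).prodMk (hasDerivAt_const t (x, y))
  exact (HasFDerivAt.comp_hasDerivAt (l := packed u) t hu.hasFDerivAt hin).deriv

theorem inner_gradX (hu : DifferentiableAt ℝ (packed u) (t, x, y)) (v : E d) :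
    ⟪gradX u t x y, v⟫_ℝ = fderiv ℝ (packed u) (t, x, y) (0, v, 0) := by
  have hin : HasFDerivAt (fun x : E d => (t, x, y)) ((0 : E d →L[ℝ] ℝ).prod
      ((ContinuousLinearMap.id ℝ (E d)).prod (0 : E d →L[ℝ] E d))) x :=
    (hasFDerivAt_const t x).prodMk ((hasFDerivAt_id x).prodMk (hasFDerivAt_const y x))
  have h := HasFDerivAt.comp x (g := packed u) hu.hasFDerivAt hin
  rw [gradX, inner_gradient]
  exact congrArg (fun L : E d →L[ℝ] ℝ => L v) h.fderiv

theorem inner_gradY (hu : DifferentiableAt ℝ (packed u) (t, x, y)) (v : E d) :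
    ⟪gradY u t x y, v⟫_ℝ = fderiv ℝ (packed u) (t, x, y) (0, 0, v) := by
  have hin : HasFDerivAt (fun y : E d => (t, x, y)) ((0 : E d →L[ℝ] ℝ).prod
      ((0 : E d →L[ℝ] E d).prod (ContinuousLinearMap.id ℝ (E d)))) y :=
    (hasFDerivAt_const t y).prodMk ((hasFDerivAt_const x y).prodMk (hasFDerivAt_id y))
  have h := HasFDerivAt.comp y (g := packed u) hu.hasFDerivAt hin
  rw [gradY, inner_gradient]
  exact congrArg (fun L : E d →L[ℝ] ℝ => L v) h.fderiv

theorem fderiv_packed (hu : DifferentiableAt ℝ (packed u) (t, x, y)) (τ : ℝ) (v w : E d) :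
    fderiv ℝ (packed u) (t, x, y) (τ, v, w) =
      τ * derivT u t x y + ⟪gradX u t x y, v⟫_ℝ + ⟪gradY u t x y, w⟫_ℝ := by
  rw [derivT_eq hu, inner_gradX hu, inner_gradY hu, ← smul_eq_mul, ← map_smul, ← map_add, ← map_add]
  simp

theorem contDiffAt_gradY {z : ℝ × E d × E d} (hu : ContDiffAt ℝ 2 (packed u) z) :
    ContDiffAt ℝ 1 (fun z : ℝ × E d × E d => gradY u z.1 z.2.1 z.2.2) z := by
  refine contDiffAt_of_inner fun v => ?_
  have h1 : ContDiffAt ℝ 1 (fun z => fderiv ℝ (packed u) z (0, 0, v)) z :=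
    (hu.fderiv_right (m := 1) (by norm_num)).clm_apply contDiffAt_const
  refine h1.congr_of_eventuallyEq ?_
  filter_upwards [hu.eventually (by simp)] with z' hz'
  exact inner_gradY (hz'.differentiableAt (by simp)) v

end Partial

variable {t : ℝ} {x₀ y₀ : E d} {ζ : E d × E d} {γ : ℝ → Phase d}

/-- The projection `(x, y, p, q) ↦ (x, y)`. -/
def baseProj : Phase d →L[ℝ] E d × E d :=
  (ContinuousLinearMap.fst ℝ (E d) (E d × E d × E d)).prod
    ((ContinuousLinearMap.fst ℝ (E d) (E d × E d)).comp
      (ContinuousLinearMap.snd ℝ (E d) (E d × E d × E d)))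

@[simp]
theorem baseProj_apply (z : Phase d) : baseProj z = (z.1, z.2.1) := rfl

/-- The inclusion `(p, q) ↦ (0, 0, p, q)`. -/
def momIncl : E d × E d →L[ℝ] Phase d :=
  (ContinuousLinearMap.inr ℝ (E d) (E d × E d × E d)).comp
    (ContinuousLinearMap.inr ℝ (E d) (E d × E d))

@[simp]
theorem momIncl_apply (δ : E d × E d) : momIncl δ = (0, 0, δ) := rfl

theorem hasFDerivAt_momIncl (x₀ y₀ : E d) (ζ : E d × E d) :
    HasFDerivAt (fun ζ : E d × E d => ((x₀, y₀, ζ) : Phase d)) momIncl ζ :=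
  HasFDerivAt.comp ζ (g := fun w => (x₀, w)) (hasFDerivAt_prodMk_right x₀ (y₀, ζ))
    (hasFDerivAt_prodMk_right y₀ ζ)

theorem IsFlowNear.eventually_characteristic {Γ D}
    (hΓ : IsFlowNear (hamField g) t (x₀, y₀, ζ) Γ D) :
    ∀ᶠ ζ' in 𝓝 ζ, IsCharacteristic g t x₀ y₀ ζ' (Γ (x₀, y₀, ζ')) := by
  filter_upwards [(hasFDerivAt_momIncl x₀ y₀ ζ).continuousAt.eventually hΓ.sol] with ζ' h
  exact isCharacteristic_iff.2 h

theorem IsFlowNear.hasFDerivAt_momenta {Γ D}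
    (hΓ : IsFlowNear (hamField g) t (x₀, y₀, ζ) Γ D) {s : ℝ} (hs : s ∈ Set.Icc 0 t) :
    HasFDerivAt (fun ζ' => Γ (x₀, y₀, ζ') s) ((D s).comp momIncl) ζ :=
  HasFDerivAt.comp ζ (g := fun z => Γ z s) (hΓ.deriv s hs) (hasFDerivAt_momIncl x₀ y₀ ζ)

theorem IsFlowNear.fderiv_endpoint {Γ D} (hg : IsMetric g)
    (hΓ : IsFlowNear (hamField g) t (x₀, y₀, ζ) Γ D) {s : ℝ} (hs : s ∈ Set.Icc 0 t) :
    fderiv ℝ (endpoint g s x₀ y₀) ζ = baseProj.comp ((D s).comp momIncl) := by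
  refine HasFDerivAt.fderiv ?_
  refine (baseProj.hasFDerivAt.comp ζ (hΓ.hasFDerivAt_momenta hs)).congr_of_eventuallyEq ?_
  filter_upwards [hΓ.eventually_characteristic] with ζ' h
  exact hg.endpoint_eq hs.1 (h.mono hs.2)

theorem IsMetric.eventually_mem_momenta' (hg : IsMetric g) (ht : 0 ≤ t) {c : ℝ≥0∞}
    (h : ζ ∈ momenta g c t x₀ y₀) : ∀ᶠ ζ' in 𝓝 ζ, ζ' ∈ momenta g c t x₀ y₀ :=
  (hasFDerivAt_prodMk_right (𝕜 := ℝ) y₀ ζ).continuousAt.eventually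
    (hg.eventually_mem_momenta ht h)

/-- First variation of the action: the integrand is the derivative of `p·δx + q·δy`, which vanishes
at time 0 because only the initial momenta vary. -/
theorem IsFlowNear.integral_fderiv_lagrangian {Γ D} (hg : IsMetric g) (ht : 0 ≤ t)
    (hΓ : IsFlowNear (hamField g) t (x₀, y₀, ζ) Γ D) (δ : E d × E d) :
    ∫ s in (0 : ℝ)..t, fderiv ℝ (lagrangian g) (Γ (x₀, y₀, ζ) s) (D s (momIncl δ)) =
      ⟪(Γ (x₀, y₀, ζ) t).2.2.1, (D t (momIncl δ)).1⟫_ℝ +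
      ⟪(Γ (x₀, y₀, ζ) t).2.2.2, (D t (momIncl δ)).2.1⟫_ℝ := by
  have hsol := hΓ.sol.self_of_nhds
  set γ := Γ (x₀, y₀, ζ)
  have hDc : ContinuousOn (fun s => D s (momIncl δ)) (Set.Icc 0 t) := fun s hs =>
    (hΓ.variation (momIncl δ) s hs).continuousWithinAt
  have hk : ∀ s ∈ Set.Icc 0 t, HasDerivWithinAt
      (fun s => ⟪(γ s).2.2.1, (D s (momIncl δ)).1⟫_ℝ + ⟪(γ s).2.2.2, (D s (momIncl δ)).2.1⟫_ℝ)
      (fderiv ℝ (lagrangian g) (γ s) (D s (momIncl δ))) (Set.Icc 0 t) s := by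
    intro s hs
    have h1 := hsol.ode s hs
    have h2 := hΓ.variation (momIncl δ) s hs
    have hp : HasDerivWithinAt (fun s => (γ s).2.2.1) (hamField g (γ s)).2.2.1 (Set.Icc 0 t) s :=
      h1.snd.snd.fst
    have hq : HasDerivWithinAt (fun s => (γ s).2.2.2) (hamField g (γ s)).2.2.2 (Set.Icc 0 t) s :=
      h1.snd.snd.snd
    refine ((hp.inner ℝ h2.fst).add (hq.inner ℝ h2.snd.fst)).congr_deriv ?_
    rw [hg.fderiv_lagrangian]
    ring
  rw [intervalIntegral.integral_eq_sub_of_hasDerivAt_of_le ht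
    (fun s hs => (hk s hs).continuousWithinAt)
    (fun s hs => (hk s ⟨hs.1.le, hs.2.le⟩).hasDerivAt (Icc_mem_nhds hs.1 hs.2))]
  · simp [hΓ.variation_zero]
  · apply ContinuousOn.intervalIntegrable
    rw [Set.uIcc_of_le ht]
    have h3 : Continuous (fderiv ℝ (lagrangian g)) :=
      hg.contDiff_lagrangian.continuous_fderiv (by simp)
    exact (h3.comp_continuousOn hsol.continuousOn).clm_apply hDc

/-- Differentiate `S(t, X, Y) = action` in the initial momenta, by the chain rule on one side and by
the first variation on the other. Since `J ≠ 0`, the endpoint variations fill all directions, so the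
momenta are determined. -/
theorem IsMetric.gradient_twoPoint (hg : IsMetric g) {T : ℝ} {c : ℝ≥0∞}
    {S : ℝ → E d → E d → ℝ} (hS : IsTwoPointFunction g T c x₀ y₀ S) (ht : t ∈ Set.Ioo 0 T)
    (hζ : ζ ∈ momenta g c t x₀ y₀) (hγ : IsCharacteristic g t x₀ y₀ ζ γ)
    (hJ : jac g t x₀ y₀ ζ ≠ 0)
    (hd : DifferentiableAt ℝ (packed S) (t, (γ t).1, (γ t).2.1)) :
    gradX S t (γ t).1 (γ t).2.1 = (γ t).2.2.1 ∧ gradY S t (γ t).1 (γ t).2.1 = (γ t).2.2.2 := by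
  obtain ⟨Γ, D, hΓ, hΓγ⟩ := exists_isFlowNear ht.1.le hg.contDiff_hamField
    (isCharacteristic_iff.1 hγ)
  have htt : t ∈ Set.Icc 0 t := ⟨ht.1.le, le_rfl⟩
  have hΓt : Γ (x₀, y₀, ζ) t = γ t := hΓγ htt
  obtain ⟨A, hA, hAeq⟩ := hΓ.integral _ hg.contDiff_lagrangian
  have h1 : HasFDerivAt (fun ζ' => ∫ s in (0 : ℝ)..t, lagrangian g (Γ (x₀, y₀, ζ') s))
      (A.comp momIncl) ζ :=
    HasFDerivAt.comp ζ (g := fun z => ∫ s in (0 : ℝ)..t, lagrangian g (Γ z s)) hA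
      (hasFDerivAt_momIncl x₀ y₀ ζ)
  have hin : HasFDerivAt (fun ζ' => (t, baseProj (Γ (x₀, y₀, ζ') t)))
      ((0 : E d × E d →L[ℝ] ℝ).prod (baseProj.comp ((D t).comp momIncl))) ζ :=
    (hasFDerivAt_const t ζ).prodMk (baseProj.hasFDerivAt.comp ζ (hΓ.hasFDerivAt_momenta htt))
  have hd' : HasFDerivAt (packed S) (fderiv ℝ (packed S) (t, (γ t).1, (γ t).2.1))
      (t, baseProj (Γ (x₀, y₀, ζ) t)) := by
    rw [hΓt]; exact hd.hasFDerivAt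
  have h2 := HasFDerivAt.comp ζ (g := packed S)
    (f := fun ζ' => (t, baseProj (Γ (x₀, y₀, ζ') t))) hd' hin
  have heq : (packed S ∘ fun ζ' => (t, baseProj (Γ (x₀, y₀, ζ') t))) =ᶠ[𝓝 ζ]
      fun ζ' => ∫ s in (0 : ℝ)..t, lagrangian g (Γ (x₀, y₀, ζ') s) := by
    filter_upwards [hΓ.eventually_characteristic, hg.eventually_mem_momenta' ht.1.le hζ]
      with ζ' hc hm
    exact hS t ht ζ' hm _ hc
  have h3 := (h1.congr_of_eventuallyEq heq).unique h2
  have key : ∀ v : E d × E d,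
      ⟪gradX S t (γ t).1 (γ t).2.1 - (γ t).2.2.1, v.1⟫_ℝ +
      ⟪gradY S t (γ t).1 (γ t).2.1 - (γ t).2.2.2, v.2⟫_ℝ = 0 := by
    intro v
    rw [jac, hΓ.fderiv_endpoint hg htt] at hJ
    obtain ⟨δ, rfl⟩ :=
      (ContinuousLinearMap.toContinuousLinearEquivOfDetNeZero _ hJ).surjective v
    have h4 : A (momIncl δ) = fderiv ℝ (packed S) (t, (γ t).1, (γ t).2.1)
      (0, (D t (momIncl δ)).1, (D t (momIncl δ)).2.1) := DFunLike.congr_fun h3 δ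
    rw [hAeq, hΓ.integral_fderiv_lagrangian hg ht.1.le, fderiv_packed hd, hΓt] at h4
    change ⟪_, (D t (momIncl δ)).1⟫_ℝ + ⟪_, (D t (momIncl δ)).2.1⟫_ℝ = 0
    rw [inner_sub_left, inner_sub_left]
    linarith
  constructor
  · refine sub_eq_zero.1 (ext_inner_right ℝ fun v => ?_)
    simpa using key (v, 0)
  · refine sub_eq_zero.1 (ext_inner_right ℝ fun v => ?_)
    simpa using key (0, v)

end TwoPoint

/-! ### The amplitude along characteristics -/

section Amplitude

variable {d : ℕ} {g : E d → E d →L[ℝ] E d}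

/-- The velocity field `(∂H/∂p, ∂H/∂q)` with momenta given by the gradient of `S`. -/
def velocity (g : E d → E d →L[ℝ] E d) (S : ℝ → E d → E d → ℝ) (s : ℝ) (w : E d × E d) :
    E d × E d :=
  (-coG g w.1 w.2, g w.1 (gradY S s w.1 w.2) + (1 / 2 : ℝ) • force g w.1 w.2)

theorem IsMetric.hasFDerivAt_force (hg : IsMetric g) (x y : E d) :
    HasFDerivAt (force g x) (fderiv ℝ (force g x) y) y := by
  have h : ContDiff ℝ ∞ (force g x) :=
    ContDiff.comp (g := fun w : E d × E d => force g w.1 w.2) (f := fun y => (x, y))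
      hg.contDiff_force (contDiff_const.prodMk contDiff_id)
  exact (h.differentiable (by simp) y).hasFDerivAt

theorem IsMetric.inner_fderiv_force (hg : IsMetric g) (x y v w : E d) :
    ⟪fderiv ℝ (force g x) y w, v⟫_ℝ = 2 * ⟪fderiv ℝ (coG g) x v y, w⟫_ℝ := by
  have h1 : HasFDerivAt (fun y => ⟪force g x y, v⟫_ℝ) _ y :=
    (hg.hasFDerivAt_force x y).inner ℝ (hasFDerivAt_const v y)
  have h2 : HasFDerivAt (fun y => ⟪fderiv ℝ (coG g) x v y, y⟫_ℝ) _ y :=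
    (fderiv ℝ (coG g) x v).hasFDerivAt.inner ℝ (hasFDerivAt_id y)
  simp_rw [hg.inner_force] at h1
  have h3 := DFunLike.congr_fun (h1.unique h2) w
  simp at h3
  rw [h3, hg.fderiv_coG_symm x v w y, real_inner_comm w]
  ring

/-- The force is the `x`-gradient of a quadratic form in `y`, so both traces are contractions of the
same mixed derivatives of `(G y, y)`. The factor 2 comes from the symmetry of `∂G`. -/
theorem IsMetric.trace_fderiv_force (hg : IsMetric g) (x y : E d) :
    LinearMap.trace ℝ (E d) (fderiv ℝ (force g x) y : E d →ₗ[ℝ] E d) =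
      2 * LinearMap.trace ℝ (E d) ((fderiv ℝ (coG g) x).flip y : E d →ₗ[ℝ] E d) := by
  rw [LinearMap.trace_eq_sum_inner _ (EuclideanSpace.basisFun (Fin d) ℝ),
    LinearMap.trace_eq_sum_inner _ (EuclideanSpace.basisFun (Fin d) ℝ), Finset.mul_sum]
  refine Finset.sum_congr rfl fun i _ => ?_
  rw [real_inner_comm]
  refine (hg.inner_fderiv_force x y _ _).trans ?_
  rw [real_inner_comm]
  rfl

/-- The divergence of `-G y` in `x` cancels that of half the force in `y`; only `tr(g ∂_y²S)`
remains, the coefficient in the transport equation. -/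
theorem IsMetric.exists_fderiv_velocity (hg : IsMetric g) {S : ℝ → E d → E d → ℝ} {s : ℝ}
    {x y : E d} (hS : ContDiffAt ℝ 2 (packed S) (s, x, y)) :
    ∃ A : E d × E d →L[ℝ] E d × E d, HasFDerivAt (velocity g S s) A (x, y) ∧
      LinearMap.trace ℝ (E d × E d) A = trHessY g S s x y := by
  have hq : DifferentiableAt ℝ (fun w : E d × E d => gradY S s w.1 w.2) (x, y) := by
    have h1 := (contDiffAt_gradY hS).differentiableAt (by simp)
    exact DifferentiableAt.comp (x, y)
      (g := fun z : ℝ × E d × E d => gradY S z.1 z.2.1 z.2.2)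
      (f := fun w : E d × E d => (s, w)) h1
      ((differentiableAt_const s).prodMk differentiableAt_id)
  have hgx : DifferentiableAt ℝ (fun w : E d × E d => g w.1) (x, y) :=
    DifferentiableAt.comp (x, y) (g := g) (hg.smooth.differentiable (by simp) x) differentiableAt_fst
  have hGx : DifferentiableAt ℝ (fun w : E d × E d => coG g w.1) (x, y) :=
    DifferentiableAt.comp (x, y) (g := coG g) (hg.contDiff_coG.differentiable (by simp) x)
      differentiableAt_fst
  have hf : DifferentiableAt ℝ (fun w : E d × E d => force g w.1 w.2) (x, y) :=
    hg.contDiff_force.differentiable (by simp) _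
  have hU : DifferentiableAt ℝ (velocity g S s) (x, y) :=
    (hGx.clm_apply differentiableAt_snd).neg.prodMk
      ((hgx.clm_apply hq).add (hf.const_smul (1 / 2 : ℝ)))
  set A := fderiv ℝ (velocity g S s) (x, y)
  have hA : HasFDerivAt (velocity g S s) A (x, y) := hU.hasFDerivAt
  refine ⟨A, hA, ?_⟩
  have hinl : HasFDerivAt (fun x' => -coG g x' y)
      ((ContinuousLinearMap.fst ℝ (E d) (E d)).comp (A.comp (ContinuousLinearMap.inl ℝ _ _))) x :=
    (HasFDerivAt.comp x (g := velocity g S s) (f := fun x' => (x', y)) hA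
      (hasFDerivAt_prodMk_left x y)).fst
  have hinr : HasFDerivAt (fun y' => g x (gradY S s x y') + (1 / 2 : ℝ) • force g x y')
      ((ContinuousLinearMap.snd ℝ (E d) (E d)).comp (A.comp (ContinuousLinearMap.inr ℝ _ _))) y :=
    (HasFDerivAt.comp y (g := velocity g S s) (f := fun y' => (x, y')) hA
      (hasFDerivAt_prodMk_right x y)).snd
  have hinl' : HasFDerivAt (fun x' => -coG g x' y) (-(fderiv ℝ (coG g) x).flip y) x := by
    have := ((hg.hasFDerivAt_coG x).clm_apply (hasFDerivAt_const y x)).neg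
    refine this.congr_fderiv ?_
    ext v
    simp
  have hqy : HasFDerivAt (fun y' => gradY S s x y') (fderiv ℝ (fun y' => gradY S s x y') y) y :=
    (DifferentiableAt.comp y (g := fun w : E d × E d => gradY S s w.1 w.2)
      (f := fun y' => (x, y')) hq (hasFDerivAt_prodMk_right x y).differentiableAt).hasFDerivAt
  have hinr' : HasFDerivAt (fun y' => g x (gradY S s x y') + (1 / 2 : ℝ) • force g x y')
      ((g x).comp (fderiv ℝ (fun y' => gradY S s x y') y) +
        (1 / 2 : ℝ) • fderiv ℝ (force g x) y) y :=
    ((g x).hasFDerivAt.comp y hqy).add ((hg.hasFDerivAt_force x y).const_smul (1 / 2 : ℝ))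
  have e1 := congrArg (fun L : E d →L[ℝ] E d => LinearMap.trace ℝ (E d) (L : E d →ₗ[ℝ] E d))
    (hinl.unique hinl')
  have e2 := congrArg (fun L : E d →L[ℝ] E d => LinearMap.trace ℝ (E d) (L : E d →ₗ[ℝ] E d))
    (hinr.unique hinr')
  simp only [ContinuousLinearMap.toLinearMap_neg, ContinuousLinearMap.toLinearMap_add,
    ContinuousLinearMap.toLinearMap_smul, map_neg, map_add, map_smul, hg.trace_fderiv_force,
    smul_eq_mul] at e1 e2
  rw [trace_prod_eq]
  refine (congrArg₂ (· + ·) e1 e2).trans ?_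
  simp only [trHessY]
  ring

variable {T t : ℝ} {b c r : ℝ≥0∞} {x₀ y₀ : E d} {ζ : E d × E d} {γ : ℝ → Phase d}
  {S φ : ℝ → E d → E d → ℝ}

theorem IsMetric.mem_reached (hg : IsMetric g) (hζ : ζ ∈ momenta g c t x₀ y₀)
    (hγ : IsCharacteristic g t x₀ y₀ ζ γ) (ht : t ∈ Set.Ioo 0 T) :
    (t, (γ t).1, (γ t).2.1) ∈ reached g T c x₀ y₀ :=
  ⟨ht, ζ, hζ, hg.endpoint_eq ht.1.le hγ⟩

theorem UniquelySolvable.hasDerivAt_jac (h : UniquelySolvable g T b c r x₀) (hg : IsMetric g)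
    (hb : ∀ t ∈ Set.Ioo 0 T, ENNReal.ofReal (t * ‖y₀‖) < b)
    (hS : ContDiffOn ℝ 2 (packed S) (reached g T c x₀ y₀))
    (hS2 : IsTwoPointFunction g T c x₀ y₀ S) (ht : t ∈ Set.Ioo 0 T)
    (hζ : ζ ∈ momenta g c t x₀ y₀) (hγ : IsCharacteristic g t x₀ y₀ ζ γ) {s : ℝ}
    (hs : s ∈ Set.Ioo 0 t) :
    HasDerivAt (fun r => jac g r x₀ y₀ ζ)
      (trHessY g S s (γ s).1 (γ s).2.1 * jac g s x₀ y₀ ζ) s := by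
  have hopen := h.isOpen_reached hg hb
  have hsT : s ∈ Set.Ioo 0 T := ⟨hs.1, hs.2.trans ht.2⟩
  have hsI : s ∈ Set.Icc 0 t := ⟨hs.1.le, hs.2.le⟩
  have hζs := momenta_mono hs.1.le hs.2.le hζ
  have hγs := hγ.mono hs.2.le
  obtain ⟨Γ, D, hΓ, hΓγ⟩ := exists_isFlowNear ht.1.le hg.contDiff_hamField
    (isCharacteristic_iff.1 hγ)
  have hΓs : Γ (x₀, y₀, ζ) s = γ s := hΓγ hsI
  set M : ℝ → E d × E d →L[ℝ] E d × E d := fun r => baseProj.comp ((D r).comp momIncl)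
  have hJM : ∀ r ∈ Set.Icc 0 t, jac g r x₀ y₀ ζ = (M r).det := fun r hr => by
    rw [jac, hΓ.fderiv_endpoint hg hr]
  have hreach := hg.mem_reached hζs hγs hsT
  obtain ⟨A, hA, hAtr⟩ := hg.exists_fderiv_velocity (hS.contDiffAt (hopen.mem_nhds hreach))
  have hVΓ : HasFDerivAt (fun ζ' => baseProj (hamField g (Γ (x₀, y₀, ζ') s)))
      (baseProj.comp ((fderiv ℝ (hamField g) (γ s)).comp ((D s).comp momIncl))) ζ := by
    have hV : HasFDerivAt (hamField g) (fderiv ℝ (hamField g) (γ s)) (Γ (x₀, y₀, ζ) s) := by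
      rw [hΓs]
      exact (hg.contDiff_hamField.differentiable (by simp) _).hasFDerivAt
    exact baseProj.hasFDerivAt.comp ζ (HasFDerivAt.comp ζ (g := hamField g)
      (f := fun ζ' => Γ (x₀, y₀, ζ') s) hV (hΓ.hasFDerivAt_momenta hsI))
  have hUΓ : HasFDerivAt (fun ζ' => velocity g S s (baseProj (Γ (x₀, y₀, ζ') s)))
      (A.comp (M s)) ζ := by
    have hA' : HasFDerivAt (velocity g S s) A (baseProj (Γ (x₀, y₀, ζ) s)) := by
      rw [hΓs]; exact hA
    exact HasFDerivAt.comp ζ (g := velocity g S s)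
      (f := fun ζ' => baseProj (Γ (x₀, y₀, ζ') s)) hA'
      (baseProj.hasFDerivAt.comp ζ (hΓ.hasFDerivAt_momenta hsI))
  -- Nearby momenta are also admissible, so their characteristics too have fibre momentum `∂_yS`.
  -- Differentiating this identity in `ζ'` closes the variational equation on the base: `M' = A M`.
  have heq : (fun ζ' => baseProj (hamField g (Γ (x₀, y₀, ζ') s))) =ᶠ[𝓝 ζ]
      fun ζ' => velocity g S s (baseProj (Γ (x₀, y₀, ζ') s)) := by
    filter_upwards [hΓ.eventually_characteristic, hg.eventually_mem_momenta' hs.1.le hζs]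
      with ζ' hc hm
    have hc' := hc.mono hs.2.le
    have hgr := (hg.gradient_twoPoint hS2 hsT hm hc' (h.jac_ne s hsT y₀ (hb s hsT) ζ' hm)
      ((hS.contDiffAt (hopen.mem_nhds (hg.mem_reached hm hc' hsT))).differentiableAt
        (by simp))).2
    simp only [baseProj_apply, velocity, hgr]
    rw [hamField_fst, hg.hamField_snd]
  have hcomp := (hUΓ.congr_of_eventuallyEq heq).unique hVΓ
  have hsn : Set.Icc 0 t ∈ 𝓝 s := Icc_mem_nhds hs.1 hs.2
  have hM : ∀ v, HasDerivAt (fun r => M r v) (A (M s v)) s := by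
    intro v
    have h1 := (hΓ.variation (momIncl v) s hsI).hasDerivAt hsn
    have h2 := (baseProj (d := d)).hasFDerivAt.comp_hasDerivAt s h1
    refine h2.congr_deriv ?_
    rw [hΓs]
    exact (DFunLike.congr_fun hcomp v).symm
  have hne : (M s).det ≠ 0 := by
    rw [← hJM s hsI]
    exact h.jac_ne s hsT y₀ (hb s hsT) ζ hζs
  have hdet := hasDerivAt_det hne hM
  rw [hAtr, ← hJM s hsI] at hdet
  refine hdet.congr_of_eventuallyEq ?_
  filter_upwards [hsn] with r hr
  exact hJM r hr

/-- Since `q = ∂_yS` along the characteristic, the first-order part of the transport equation is the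
total time derivative of `φ` along it. -/
theorem UniquelySolvable.hasDerivAt_amplitude (h : UniquelySolvable g T b c r x₀)
    (hg : IsMetric g) (hb : ∀ t ∈ Set.Ioo 0 T, ENNReal.ofReal (t * ‖y₀‖) < b)
    (hS : ContDiffOn ℝ 2 (packed S) (reached g T c x₀ y₀))
    (hφ : ContDiffOn ℝ 2 (packed φ) (reached g T c x₀ y₀))
    (hS2 : IsTwoPointFunction g T c x₀ y₀ S) (htr : Transport g (reached g T c x₀ y₀) S φ)
    (ht : t ∈ Set.Ioo 0 T)
    (hζ : ζ ∈ momenta g c t x₀ y₀) (hγ : IsCharacteristic g t x₀ y₀ ζ γ) {s : ℝ}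
    (hs : s ∈ Set.Ioo 0 t) :
    HasDerivAt (fun r => φ r (γ r).1 (γ r).2.1)
      (-(1 / 2) * φ s (γ s).1 (γ s).2.1 * trHessY g S s (γ s).1 (γ s).2.1) s := by
  have hopen := h.isOpen_reached hg hb
  have hsT : s ∈ Set.Ioo 0 T := ⟨hs.1, hs.2.trans ht.2⟩
  have hζs := momenta_mono hs.1.le hs.2.le hζ
  have hγs := hγ.mono hs.2.le
  have hreach := hg.mem_reached hζs hγs hsT
  have hγd := (hγ.ode s ⟨hs.1.le, hs.2.le⟩).hasDerivAt (Icc_mem_nhds hs.1 hs.2)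
  have hφd : DifferentiableAt ℝ (packed φ) (s, (γ s).1, (γ s).2.1) :=
    (hφ.contDiffAt (hopen.mem_nhds hreach)).differentiableAt (by simp)
  have hSd : DifferentiableAt ℝ (packed S) (s, (γ s).1, (γ s).2.1) :=
    (hS.contDiffAt (hopen.mem_nhds hreach)).differentiableAt (by simp)
  have hin : HasDerivAt (fun r => (r, (γ r).1, (γ r).2.1))
      (1, (hamField g (γ s)).1, (hamField g (γ s)).2.1) s :=
    (hasDerivAt_id s).prodMk (hγd.fst.prodMk hγd.snd.fst)
  have h1 := HasFDerivAt.comp_hasDerivAt (l := packed φ) s hφd.hasFDerivAt hin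
  refine h1.congr_deriv ?_
  have hgr := (hg.gradient_twoPoint hS2 hsT hζs hγs (h.jac_ne s hsT y₀ (hb s hsT) ζ hζs) hSd).2
  rw [fderiv_packed hφd, hamField_fst, hg.hamField_snd, ← hgr]
  have h2 := htr _ _ _ hreach
  rw [inner_add_right, inner_smul_right, inner_neg_right,
    real_inner_comm (coG g (γ s).1 (γ s).2.1),
    real_inner_comm (force g (γ s).1 (γ s).2.1), real_inner_comm (g (γ s).1 _)]
  linarith

theorem hasDerivAt_sqrt_abs {f : ℝ → ℝ} {a s : ℝ} (hf : HasDerivAt f (a * f s) s)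
    (h0 : f s ≠ 0) : HasDerivAt (fun r => √|f r|) (a / 2 * √|f s|) s := by
  have h1 : HasDerivAt (fun r => |f r|) (a * |f s|) s := by
    rcases h0.lt_or_gt with hlt | hgt
    · have : (fun r => |f r|) =ᶠ[𝓝 s] fun r => -f r := by
        filter_upwards [hf.continuousAt.eventually (gt_mem_nhds hlt)] with r hr
        exact abs_of_neg hr
      rw [abs_of_neg hlt, mul_neg]
      exact hf.neg.congr_of_eventuallyEq this
    · have : (fun r => |f r|) =ᶠ[𝓝 s] f := by
        filter_upwards [hf.continuousAt.eventually (lt_mem_nhds hgt)] with r hr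
        exact abs_of_pos hr
      rw [abs_of_pos hgt]
      exact hf.congr_of_eventuallyEq this
  refine (h1.sqrt (abs_pos.2 h0).ne').congr_deriv ?_
  have hpos : 0 < √|f s| := Real.sqrt_pos.2 (abs_pos.2 h0)
  field_simp
  rw [Real.sq_sqrt (abs_nonneg _)]

end Amplitude

/-! ### The conserved quantity and the closed form of the amplitude -/

section AmplitudeFormula

variable {d : ℕ} {g : E d → E d →L[ℝ] E d}
  {T t : ℝ} {b c r : ℝ≥0∞} {x₀ y₀ : E d} {ζ : E d × E d} {γ : ℝ → Phase d}
  {S φ : ℝ → E d → E d → ℝ}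

theorem IsMetric.hamField_rest (hg : IsMetric g) (x : E d) : hamField g (x, 0, 0, 0) = 0 := by
  have hf : ∀ x', force g x' 0 = 0 := fun x' => by
    simpa using force_smul 0 hg x' (0 : E d)
  refine Prod.ext ?_ (Prod.ext ?_ (Prod.ext ?_ ?_))
  · simp [hamField_fst]
  · simp [hg.hamField_snd, hf]
  · simp [hamField, ham]
  · simp [hamField, ham]

/-- The dilated data tend to 0 as the time does; the limit is admissible because `(x₀, 0, 0, 0)` is
a rest point. -/
theorem IsMetric.zero_mem_unitMomenta (hg : IsMetric g) (hb : 0 < b) (hc : 0 < c) :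
    (0 : E d × E d × E d) ∈ unitMomenta g b c x₀ := by
  refine ⟨by simpa using hb, by simpa using hc, by simpa using hc, fun _ => (x₀, 0, 0, 0), rfl, ?_⟩
  intro s _
  rw [hg.hamField_rest]
  exact hasDerivWithinAt_const _ _ _

/-- The starting data `(s y₀, s³ p₀, s² q₀)` of the dilated characteristic. -/
def dilData (y₀ : E d) (ζ : E d × E d) (s : ℝ) : E d × E d × E d := (s • y₀, dilMom s ζ)

theorem continuous_dilData (y₀ : E d) (ζ : E d × E d) : Continuous (dilData y₀ ζ) := by
  unfold dilData dilMom
  fun_prop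

theorem dilData_zero (y₀ : E d) (ζ : E d × E d) : dilData y₀ ζ 0 = 0 := by
  simp [dilData, dilMom, Prod.zero_eq_mk]

theorem IsMetric.dilData_mem (hg : IsMetric g) (ht : 0 < t) (hb : ENNReal.ofReal (t * ‖y₀‖) < b)
    (hζ : ζ ∈ momenta g c t x₀ y₀) : dilData y₀ ζ t ∈ unitMomenta g b c x₀ := by
  refine ⟨?_, (hg.mem_momenta_iff c ht).1 hζ⟩
  rw [dilData, norm_smul, Real.norm_of_nonneg ht.le]
  exact hb

/-- The conserved `φ √|J|` is rewritten as `t^{2d} φ` times the root of the time-one Jacobian. Both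
factors have limits at `t = 0`: the first by the normalisation of `φ`, the second by continuity at
the rest point. -/
theorem UniquelySolvable.amplitude_formula (h : UniquelySolvable g T b c r x₀)
    (hg : IsMetric g) (hb : ∀ t ∈ Set.Ioo 0 T, ENNReal.ofReal (t * ‖y₀‖) < b)
    (hS : ContDiffOn ℝ 2 (packed S) (reached g T c x₀ y₀))
    (hφ : ContDiffOn ℝ 2 (packed φ) (reached g T c x₀ y₀))
    (hS2 : IsTwoPointFunction g T c x₀ y₀ S) (htr : Transport g (reached g T c x₀ y₀) S φ)
    {κ : ℝ} (hκ : Filter.Tendsto (fun z : ℝ × E d × E d => z.1 ^ (2 * d) * packed φ z)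
      (𝓝[reached g T c x₀ y₀] (0, x₀, y₀)) (𝓝 κ))
    (ht : t ∈ Set.Ioo 0 T)
    (hζ : ζ ∈ momenta g c t x₀ y₀) (hγ : IsCharacteristic g t x₀ y₀ ζ γ) :
    t ^ (2 * d) * φ t (γ t).1 (γ t).2.1 * √|unitJac g x₀ (dilData y₀ ζ t)| =
      κ * √|unitJac g x₀ 0| := by
  have hopen := h.isOpen_reached hg hb
  have hT : 0 < T := ht.1.trans ht.2
  have hsT : ∀ s ∈ Set.Ioc 0 t, s ∈ Set.Ioo 0 T := fun s hs => ⟨hs.1, hs.2.trans_lt ht.2⟩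
  have hζs : ∀ s ∈ Set.Ioc 0 t, ζ ∈ momenta g c s x₀ y₀ := fun s hs =>
    momenta_mono hs.1.le hs.2 hζ
  have hreach : ∀ s ∈ Set.Ioc 0 t, (s, (γ s).1, (γ s).2.1) ∈ reached g T c x₀ y₀ := fun s hs =>
    hg.mem_reached (hζs s hs) (hγ.mono hs.2) (hsT s hs)
  have hcurve : ContinuousOn (fun s => (s, (γ s).1, (γ s).2.1)) (Set.Icc 0 t) := by
    have hγc := (isCharacteristic_iff.1 hγ).continuousOn
    exact continuousOn_id.prodMk (hγc.fst.prodMk hγc.snd.fst)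
  set j : ℝ → ℝ := fun s => √|unitJac g x₀ (dilData y₀ ζ s)|
  set v : ℝ → ℝ := fun s => s ^ (2 * d) * φ s (γ s).1 (γ s).2.1 * j s
  have hjc : ∀ s, dilData y₀ ζ s ∈ unitMomenta g b c x₀ → ContinuousAt j s := by
    intro s hs
    have h1 : ContinuousAt (fun s => unitJac g x₀ (dilData y₀ ζ s)) s :=
      ContinuousAt.comp (g := unitJac g x₀) (hg.contDiffAt_unitJac hs).continuousAt
        (continuous_dilData y₀ ζ).continuousAt
    exact h1.abs.sqrt
  have hvc : ContinuousOn v (Set.Ioc 0 t) := by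
    intro s hs
    have h1 : ContinuousWithinAt (fun s => φ s (γ s).1 (γ s).2.1) (Set.Ioc 0 t) s :=
      ContinuousAt.comp_continuousWithinAt (g := packed φ)
        (f := fun s => (s, (γ s).1, (γ s).2.1))
        (hφ.contDiffAt (hopen.mem_nhds (hreach s hs))).continuousAt
        ((hcurve s ⟨hs.1.le, hs.2⟩).mono Set.Ioc_subset_Icc_self)
    exact ((continuousWithinAt_id.pow _).mul h1).mul
      (hjc s (hg.dilData_mem hs.1 (hb s (hsT s hs)) (hζs s hs))).continuousWithinAt
  -- The exponent `2d` is half of the `4d` in `IsMetric.jac_dil`.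
  have hvu : ∀ s ∈ Set.Ioc 0 t, v s = φ s (γ s).1 (γ s).2.1 * √|jac g s x₀ y₀ ζ| := by
    intro s hs
    have hpow : 0 ≤ s ^ (2 * d) := pow_nonneg hs.1.le _
    rw [hg.jac_dil hs.1 (hγ.mono hs.2), abs_mul, Real.sqrt_mul (abs_nonneg _),
      abs_of_nonneg (pow_nonneg hs.1.le _), show s ^ (4 * d) = (s ^ (2 * d)) ^ 2 by ring,
      Real.sqrt_sq hpow]
    simp only [v, j, unitJac, dilData]
    ring
  have hvd : ∀ s ∈ Set.Ioo 0 t, HasDerivAt v 0 s := by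
    intro s hs
    have hs' : s ∈ Set.Ioc 0 t := ⟨hs.1, hs.2.le⟩
    have h1 := h.hasDerivAt_amplitude hg hb hS hφ hS2 htr ht hζ hγ hs
    have h2 := hasDerivAt_sqrt_abs (h.hasDerivAt_jac hg hb hS hS2 ht hζ hγ hs)
      (h.jac_ne s (hsT s hs') y₀ (hb s (hsT s hs')) ζ (hζs s hs'))
    -- The logarithmic rates are `-½ tr` for `φ` and `+½ tr` for `√|J|`.
    have h3 : HasDerivAt (fun r => φ r (γ r).1 (γ r).2.1 * √|jac g r x₀ y₀ ζ|) 0 s :=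
      (h1.mul h2).congr_deriv (by ring)
    refine h3.congr_of_eventuallyEq ?_
    filter_upwards [Ioo_mem_nhds hs.1 hs.2] with r hr
    exact hvu r ⟨hr.1, hr.2.le⟩
  have hconst : ∀ a ∈ Set.Ioo 0 t, v a = v t := by
    intro a ha
    exact (constant_of_has_deriv_right_zero
      (hvc.mono fun s hs => ⟨ha.1.trans_le hs.1, hs.2⟩)
      (fun s hs => (hvd s ⟨ha.1.trans_le hs.1, hs.2⟩).hasDerivWithinAt) t ⟨ha.2.le, le_rfl⟩).symm
  have hlim1 : Filter.Tendsto v (𝓝[>] 0) (𝓝 (v t)) := by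
    refine tendsto_const_nhds.congr' ?_
    filter_upwards [Ioo_mem_nhdsGT ht.1] with a ha
    exact (hconst a ha).symm
  have hb0 : 0 < b := zero_le.trans_lt (hb t ht)
  have hc0 : 0 < c := zero_le.trans_lt hζ.1
  have hj0 : Filter.Tendsto j (𝓝[>] 0) (𝓝 (√|unitJac g x₀ 0|)) := by
    have h1 := hjc 0 (by rw [dilData_zero]; exact hg.zero_mem_unitMomenta hb0 hc0)
    have h2 := h1.tendsto.mono_left (nhdsWithin_le_nhds (s := Set.Ioi 0))
    simpa only [j, dilData_zero] using h2
  -- The characteristic stays in the reached set, so the limit hypothesis on `φ` applies along it.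
  have hcurve0 : Filter.Tendsto (fun s => (s, (γ s).1, (γ s).2.1)) (𝓝[>] 0)
      (𝓝[reached g T c x₀ y₀] (0, x₀, y₀)) := by
    refine tendsto_nhdsWithin_iff.2 ⟨?_, ?_⟩
    · have h1 := (hcurve 0 ⟨le_rfl, ht.1.le⟩).tendsto
      rw [hγ.init] at h1
      refine h1.mono_left ?_
      exact nhdsWithin_le_of_mem (Filter.mem_of_superset (Ioo_mem_nhdsGT ht.1)
        Set.Ioo_subset_Icc_self)
    · filter_upwards [Ioo_mem_nhdsGT ht.1] with s hs
      exact hreach s ⟨hs.1, hs.2.le⟩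
  exact tendsto_nhds_unique hlim1 ((hκ.comp hcurve0).mul hj0)

/-- The profile `|J|^{-1/2}` of the amplitude, as a function of the end points at time `1`. -/
def profile (g : E d → E d →L[ℝ] E d) (b c : ℝ≥0∞) (x₀ : E d) (o : E d × E d × E d) : ℝ :=
  (√|unitJac g x₀ (unitInverse g b c x₀ o)|)⁻¹

theorem UniquelySolvable.unitJac_inverse_ne_zero (h : UniquelySolvable g T b c r x₀)
    (hg : IsMetric g) (hT : 0 < T) {o : E d × E d × E d} (ho : o ∈ unitReached g b c x₀) :
    unitJac g x₀ (unitInverse g b c x₀ o) ≠ 0 :=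
  h.unit_jac_ne_zero hg hT (unitInverse_mem ho)

theorem UniquelySolvable.profile_pos (h : UniquelySolvable g T b c r x₀)
    (hg : IsMetric g) (hT : 0 < T) {o : E d × E d × E d} (ho : o ∈ unitReached g b c x₀) :
    0 < profile g b c x₀ o :=
  inv_pos.2 (Real.sqrt_pos.2 (abs_pos.2 (h.unitJac_inverse_ne_zero hg hT ho)))

theorem UniquelySolvable.contDiffAt_profile (h : UniquelySolvable g T b c r x₀)
    (hg : IsMetric g) (hT : 0 < T) {o : E d × E d × E d} (ho : o ∈ unitReached g b c x₀) :
    ContDiffAt ℝ ∞ (profile g b c x₀) o := by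
  have h0 := h.unitJac_inverse_ne_zero hg hT ho
  have h1 : ContDiffAt ℝ ∞ (fun o => unitJac g x₀ (unitInverse g b c x₀ o)) o :=
    ContDiffAt.comp o (g := unitJac g x₀) (hg.contDiffAt_unitJac (unitInverse_mem ho))
      (h.contDiffAt_unitInverse hg hT ho)
  exact ((h1.abs h0).sqrt (abs_pos.2 h0).ne').inv (Real.sqrt_pos.2 (abs_pos.2 h0)).ne'

theorem UniquelySolvable.amplitude_eq_profile (h : UniquelySolvable g T b c r x₀)
    (hg : IsMetric g) (hb : ∀ t ∈ Set.Ioo 0 T, ENNReal.ofReal (t * ‖y₀‖) < b)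
    (hS : ContDiffOn ℝ 2 (packed S) (reached g T c x₀ y₀))
    (hφ : ContDiffOn ℝ 2 (packed φ) (reached g T c x₀ y₀))
    (hS2 : IsTwoPointFunction g T c x₀ y₀ S) (htr : Transport g (reached g T c x₀ y₀) S φ)
    {κ : ℝ} (hκ : Filter.Tendsto (fun z : ℝ × E d × E d => z.1 ^ (2 * d) * packed φ z)
      (𝓝[reached g T c x₀ y₀] (0, x₀, y₀)) (𝓝 κ))
    {x y : E d} (hz : (t, x, y) ∈ reached g T c x₀ y₀) :
    φ t x y = κ * √|unitJac g x₀ 0| / t ^ (2 * d) *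
      profile g b c x₀ (t • y₀, x, t • y) := by
  obtain ⟨ht, ζ, hζ, he⟩ := id hz
  obtain ⟨γ, hγ⟩ := hζ.2.2
  have hT : 0 < T := lt_trans (Set.mem_Ioo.1 ht).1 (Set.mem_Ioo.1 ht).2
  have ht0 : 0 < t := ht.1
  have hmem := hg.dilData_mem ht0 (hb t ht) hζ
  have hend : unitEndpoint g x₀ (dilData y₀ ζ t) = (t • y₀, x, t • y) := by
    have he' : endpoint g t x₀ y₀ ζ = (x, y) := he
    rw [hg.endpoint_dil ht0] at he'
    obtain ⟨h1, h2⟩ := Prod.mk.inj he'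
    refine Prod.ext rfl (Prod.ext h1 ?_)
    rw [← h2, smul_inv_smul₀ ht0.ne']
    rfl
  have hform := h.amplitude_formula hg hb hS hφ hS2 htr hκ ht hζ hγ
  have hxy := (hg.endpoint_eq ht0.le hγ).symm.trans he
  obtain ⟨hx, hy⟩ := Prod.mk.inj hxy
  rw [hx, hy] at hform
  have hpos : 0 < √|unitJac g x₀ (dilData y₀ ζ t)| :=
    Real.sqrt_pos.2 (abs_pos.2 (h.unit_jac_ne_zero hg hT hmem))
  rw [← hend, profile, h.unitInverse_unitEndpoint hg hT hmem, ← hform]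
  have hp : 0 < t ^ (2 * d) := pow_pos ht0 _
  simp only at *
  field_simp

end AmplitudeFormula

/-! ### The parabolic operator applied to the ansatz -/

section Ansatz

variable {d : ℕ} {g : E d → E d →L[ℝ] E d} {S φ : ℝ → E d → E d → ℝ} {C : ℝ → ℝ} {h t : ℝ}
  {x y : E d}

theorem trace_smulRight_inner (a v : E d) :
    LinearMap.trace ℝ (E d) (((innerSL ℝ a).smulRight v : E d →L[ℝ] E d) : E d →ₗ[ℝ] E d) =
      ⟪a, v⟫_ℝ := by
  rw [LinearMap.trace_eq_sum_inner _ (EuclideanSpace.basisFun (Fin d) ℝ),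
    ← (EuclideanSpace.basisFun (Fin d) ℝ).sum_inner_mul_inner a v]
  refine Finset.sum_congr rfl fun i _ => ?_
  simp [inner_smul_right]

theorem hasFDerivAt_ansatz {z : ℝ × E d × E d} (hS : DifferentiableAt ℝ (packed S) z)
    (hφ : DifferentiableAt ℝ (packed φ) z) :
    HasFDerivAt (packed (ansatz C S φ h))
      ((C h * Real.exp (-(packed S z) / h)) •
        (fderiv ℝ (packed φ) z - (packed φ z / h) • fderiv ℝ (packed S) z)) z := by
  have h1 : HasFDerivAt (fun z => C h * packed φ z * Real.exp (-(packed S z) / h)) _ z :=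
    (hφ.hasFDerivAt.const_mul (C h)).mul ((hS.hasFDerivAt.neg.mul_const h⁻¹).exp)
  refine h1.congr_fderiv ?_
  ext δ <;>
  · simp [div_eq_mul_inv]
    ring

theorem gradY_ansatz (hS : DifferentiableAt ℝ (packed S) (t, x, y))
    (hφ : DifferentiableAt ℝ (packed φ) (t, x, y)) :
    gradY (ansatz C S φ h) t x y = (C h * Real.exp (-(S t x y) / h)) •
      (gradY φ t x y - (φ t x y / h) • gradY S t x y) := by
  have h1 := hasFDerivAt_ansatz (C := C) (h := h) hS hφ
  refine ext_inner_right ℝ fun v => ?_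
  rw [inner_gradY h1.differentiableAt, h1.fderiv, inner_smul_left, inner_sub_left, inner_smul_left,
    inner_gradY hS, inner_gradY hφ]
  rfl

theorem gradX_ansatz (hS : DifferentiableAt ℝ (packed S) (t, x, y))
    (hφ : DifferentiableAt ℝ (packed φ) (t, x, y)) :
    gradX (ansatz C S φ h) t x y = (C h * Real.exp (-(S t x y) / h)) •
      (gradX φ t x y - (φ t x y / h) • gradX S t x y) := by
  have h1 := hasFDerivAt_ansatz (C := C) (h := h) hS hφ
  refine ext_inner_right ℝ fun v => ?_
  rw [inner_gradX h1.differentiableAt, h1.fderiv, inner_smul_left, inner_sub_left, inner_smul_left,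
    inner_gradX hS, inner_gradX hφ]
  rfl

theorem derivT_ansatz (hS : DifferentiableAt ℝ (packed S) (t, x, y))
    (hφ : DifferentiableAt ℝ (packed φ) (t, x, y)) :
    derivT (ansatz C S φ h) t x y = (C h * Real.exp (-(S t x y) / h)) *
      (derivT φ t x y - (φ t x y / h) * derivT S t x y) := by
  have h1 := hasFDerivAt_ansatz (C := C) (h := h) hS hφ
  rw [derivT_eq h1.differentiableAt, h1.fderiv, derivT_eq hS, derivT_eq hφ]
  rfl

theorem hasFDerivAt_packed_y {u : ℝ → E d → E d → ℝ}
    (hu : DifferentiableAt ℝ (packed u) (t, x, y)) :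
    HasFDerivAt (fun y' => u t x y') (innerSL ℝ (gradY u t x y)) y := by
  have hin : HasFDerivAt (fun y : E d => (t, x, y)) ((0 : E d →L[ℝ] ℝ).prod
      ((0 : E d →L[ℝ] E d).prod (ContinuousLinearMap.id ℝ (E d)))) y :=
    (hasFDerivAt_const t y).prodMk ((hasFDerivAt_const x y).prodMk (hasFDerivAt_id y))
  refine (HasFDerivAt.comp y (g := packed u) hu.hasFDerivAt hin).congr_fderiv ?_
  ext v
  rw [innerSL_apply_apply, inner_gradY hu]
  rfl

theorem hasFDerivAt_gradY {u : ℝ → E d → E d → ℝ} (hu : ContDiffAt ℝ 2 (packed u) (t, x, y)) :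
    HasFDerivAt (fun y' => gradY u t x y') (fderiv ℝ (fun y' => gradY u t x y') y) y := by
  have hin : DifferentiableAt ℝ (fun y : E d => (t, x, y)) y :=
    (differentiableAt_const t).prodMk ((differentiableAt_const x).prodMk differentiableAt_id)
  exact (DifferentiableAt.comp y (g := fun z : ℝ × E d × E d => gradY u z.1 z.2.1 z.2.2)
    ((contDiffAt_gradY hu).differentiableAt (by simp)) hin).hasFDerivAt

theorem trHessY_ansatz (hg : IsMetric g) (hS : ContDiffAt ℝ 2 (packed S) (t, x, y))
    (hφ : ContDiffAt ℝ 2 (packed φ) (t, x, y)) :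
    trHessY g (ansatz C S φ h) t x y = (C h * Real.exp (-(S t x y) / h)) *
      (trHessY g φ t x y - φ t x y / h * trHessY g S t x y
        - 2 / h * ⟪g x (gradY S t x y), gradY φ t x y⟫_ℝ
        + φ t x y / h ^ 2 * ⟪g x (gradY S t x y), gradY S t x y⟫_ℝ) := by
  have hin : ContinuousAt (fun y : E d => (t, x, y)) y := by fun_prop
  have heq : (fun y' => gradY (ansatz C S φ h) t x y') =ᶠ[𝓝 y] fun y' =>
      (C h * Real.exp (-(S t x y') / h)) •
        (gradY φ t x y' - (φ t x y' / h) • gradY S t x y') := by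
    filter_upwards [hin.eventually (hS.eventually (by simp)),
      hin.eventually (hφ.eventually (by simp))] with y' h1 h2
    exact gradY_ansatz (h1.differentiableAt (by simp)) (h2.differentiableAt (by simp))
  have dS := hasFDerivAt_packed_y (hS.differentiableAt (by simp))
  have dφ := hasFDerivAt_packed_y (hφ.differentiableAt (by simp))
  have ha : HasFDerivAt (fun y' => C h * Real.exp (-(S t x y') / h))
      (-(C h * Real.exp (-(S t x y) / h) / h) • innerSL ℝ (gradY S t x y)) y := by
    refine ((dS.neg.mul_const h⁻¹).exp.const_mul (C h)).congr_fderiv ?_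
    ext v
    simp [div_eq_mul_inv]
    ring
  have hφh : HasFDerivAt (fun y' => φ t x y' / h) (h⁻¹ • innerSL ℝ (gradY φ t x y)) y := by
    simpa only [div_eq_mul_inv] using dφ.mul_const h⁻¹
  have hw : HasFDerivAt (fun y' => gradY φ t x y' - (φ t x y' / h) • gradY S t x y') _ y :=
    (hasFDerivAt_gradY hφ).sub (hφh.smul (hasFDerivAt_gradY hS))
  have hd := ha.smul hw
  have hfd := (hd.congr_of_eventuallyEq heq).fderiv
  rw [trHessY, hfd]
  set a := C h * Real.exp (-(S t x y) / h)
  set Hφ := fderiv ℝ (fun y' => gradY φ t x y') y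
  set HS := fderiv ℝ (fun y' => gradY S t x y') y
  -- The Hessian splits into full-rank and rank-one parts. Stating the split for an arbitrary `L`
  -- separates the trace computation from the operator identity; symmetry of `g` merges the two
  -- mixed rank-one terms.
  have hop : ∀ L : E d →L[ℝ] E d, L = a • ((g x).comp Hφ) - (a * (φ t x y / h)) • ((g x).comp HS)
      - (a / h) • (innerSL ℝ (gradY φ t x y)).smulRight (g x (gradY S t x y))
      - (a / h) • (innerSL ℝ (gradY S t x y)).smulRight
        (g x (gradY φ t x y) - (φ t x y / h) • g x (gradY S t x y)) →
      LinearMap.trace ℝ (E d) (L : E d →ₗ[ℝ] E d) = a *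
      (trHessY g φ t x y - φ t x y / h * trHessY g S t x y
        - 2 / h * ⟪g x (gradY S t x y), gradY φ t x y⟫_ℝ
        + φ t x y / h ^ 2 * ⟪g x (gradY S t x y), gradY S t x y⟫_ℝ) := by
    rintro L rfl
    simp only [ContinuousLinearMap.toLinearMap_sub, ContinuousLinearMap.toLinearMap_smul, map_sub,
      map_smul, trace_smulRight_inner, smul_eq_mul, inner_sub_right, inner_smul_right]
    rw [real_inner_comm (g x (gradY S t x y)) (gradY φ t x y),
      real_inner_comm (g x (gradY S t x y)) (gradY S t x y),
      ← hg.symm x (gradY S t x y) (gradY φ t x y)]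
    simp only [trHessY, Hφ, HS]
    ring
  apply hop
  ext1 v
  simp only [ContinuousLinearMap.comp_apply, add_apply, sub_apply, smul_apply,
    ContinuousLinearMap.smulRight_apply, map_add, map_sub, map_smul, smul_eq_mul]
  module

/-- Sort by powers of `h`: order 0 vanishes by Hamilton–Jacobi, order 1 by transport. -/
theorem parabolicOp_ansatz (hg : IsMetric g) (hh : 0 < h)
    (hS : ContDiffAt ℝ 2 (packed S) (t, x, y)) (hφ : ContDiffAt ℝ 2 (packed φ) (t, x, y))
    (hHJ : derivT S t x y + ham g x y (gradX S t x y) (gradY S t x y) = 0)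
    (htr : derivT φ t x y + ⟪g x (gradY S t x y), gradY φ t x y⟫_ℝ
      + (1 / 2) * φ t x y * trHessY g S t x y
      - ⟪coG g x y, gradX φ t x y⟫_ℝ + (1 / 2) * ⟪force g x y, gradY φ t x y⟫_ℝ = 0) :
    parabolicOp g h (ansatz C S φ h) t x y =
      -(h ^ 2 / 2) * C h * (trHessY g φ t x y * Real.exp (-(S t x y) / h)) := by
  have hS1 := hS.differentiableAt (by simp)
  have hφ1 := hφ.differentiableAt (by simp)
  rw [parabolicOp, hamOp, trHessY_ansatz hg hS hφ, derivT_ansatz hS1 hφ1, gradX_ansatz hS1 hφ1,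
    gradY_ansatz hS1 hφ1]
  simp only [inner_smul_right, inner_sub_right]
  rw [ham] at hHJ
  rw [eq_sub_of_add_eq hHJ]
  have h3 : derivT φ t x y = -⟪g x (gradY S t x y), gradY φ t x y⟫_ℝ
      - (1 / 2) * φ t x y * trHessY g S t x y
      + ⟪coG g x y, gradX φ t x y⟫_ℝ - (1 / 2) * ⟪force g x y, gradY φ t x y⟫_ℝ := by linarith
  rw [h3]
  field_simp
  ring

end Ansatz

/-! ### The multiplicative error bound -/

section Bound

variable {d : ℕ} {g : E d → E d →L[ℝ] E d} {T t : ℝ} {b c r : ℝ≥0∞} {x₀ y₀ : E d}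
  {S φ : ℝ → E d → E d → ℝ}

/-- The gradient of the profile in the fibre variable of the end point. -/
def profileGrad (g : E d → E d →L[ℝ] E d) (b c : ℝ≥0∞) (x₀ : E d) (o : E d × E d × E d) : E d :=
  gradient (fun η => profile g b c x₀ (o.1, o.2.1, η)) o.2.2

/-- The trace of `g` times the Hessian of the profile in the fibre variable of the end point. -/
def profileTrHess (g : E d → E d →L[ℝ] E d) (b c : ℝ≥0∞) (x₀ : E d) (o : E d × E d × E d) : ℝ :=
  LinearMap.trace ℝ (E d) ((g o.2.1 ∘L
    fderiv ℝ (fun η => profileGrad g b c x₀ (o.1, o.2.1, η)) o.2.2 : E d →L[ℝ] E d) :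
      E d →ₗ[ℝ] E d)

/-- The inclusion of the fibre direction of the end point. -/
def fibreIncl : E d →L[ℝ] E d × E d × E d :=
  (ContinuousLinearMap.inr ℝ (E d) (E d × E d)).comp (ContinuousLinearMap.inr ℝ (E d) (E d))

theorem hasFDerivAt_fibreIncl (o : E d × E d × E d) :
    HasFDerivAt (fun η : E d => (o.1, o.2.1, η)) fibreIncl o.2.2 :=
  HasFDerivAt.comp o.2.2 (g := fun w => (o.1, w)) (hasFDerivAt_prodMk_right o.1 o.2)
    (hasFDerivAt_prodMk_right o.2.1 o.2.2)

theorem UniquelySolvable.contDiffAt_profileGrad (h : UniquelySolvable g T b c r x₀)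
    (hg : IsMetric g) (hT : 0 < T) {o : E d × E d × E d} (ho : o ∈ unitReached g b c x₀) :
    ContDiffAt ℝ ∞ (profileGrad g b c x₀) o := by
  refine contDiffAt_of_inner fun v => ?_
  have h1 : ContDiffAt ℝ ∞ (fun o => fderiv ℝ (profile g b c x₀) o (fibreIncl v)) o :=
    ((h.contDiffAt_profile hg hT ho).fderiv_right (m := ∞) (by simp)).clm_apply contDiffAt_const
  refine h1.congr_of_eventuallyEq ?_
  filter_upwards [(h.isOpen_unitReached hg hT).mem_nhds ho] with o' ho'
  have h2 := HasFDerivAt.comp o'.2.2 (g := profile g b c x₀)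
    ((h.contDiffAt_profile hg hT ho').differentiableAt (by simp)).hasFDerivAt
    (hasFDerivAt_fibreIncl o')
  rw [profileGrad, inner_gradient]
  exact congrArg (fun L : E d →L[ℝ] ℝ => L v) h2.fderiv

theorem UniquelySolvable.hasFDerivAt_profileGrad (h : UniquelySolvable g T b c r x₀)
    (hg : IsMetric g) (hT : 0 < T) {o : E d × E d × E d} (ho : o ∈ unitReached g b c x₀) :
    HasFDerivAt (fun η => profileGrad g b c x₀ (o.1, o.2.1, η))
      ((fderiv ℝ (profileGrad g b c x₀) o).comp fibreIncl) o.2.2 :=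
  HasFDerivAt.comp o.2.2 (g := profileGrad g b c x₀)
    ((h.contDiffAt_profileGrad hg hT ho).differentiableAt (by simp)).hasFDerivAt
    (hasFDerivAt_fibreIncl o)

/-- On the open reached set the partial Hessian is a restriction of the full derivative of
`profileGrad`, which is jointly continuous in all variables. -/
theorem UniquelySolvable.continuousOn_profileTrHess (h : UniquelySolvable g T b c r x₀)
    (hg : IsMetric g) (hT : 0 < T) :
    ContinuousOn (profileTrHess g b c x₀) (unitReached g b c x₀) := by
  intro o ho
  have h1 : ContinuousAt (fun o => (g o.2.1).comp
      ((fderiv ℝ (profileGrad g b c x₀) o).comp fibreIncl)) o := by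
    have hg1 : ContinuousAt (fun o : E d × E d × E d => g o.2.1) o :=
      (hg.smooth.continuous.comp continuous_snd.fst).continuousAt
    have h2 : ContinuousAt (fderiv ℝ (profileGrad g b c x₀)) o :=
      ((h.contDiffAt_profileGrad hg hT ho).fderiv_right (m := 0) (by simp)).continuousAt
    exact hg1.clm_comp (h2.clm_comp continuousAt_const)
  set tr : (E d →L[ℝ] E d) →ₗ[ℝ] ℝ :=
    (LinearMap.trace ℝ (E d)) ∘ₗ ContinuousLinearMap.coeLM ℝ
  have htr : Continuous tr := tr.continuous_of_finiteDimensional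
  refine ContinuousWithinAt.congr (f := fun o => tr ((g o.2.1).comp
      ((fderiv ℝ (profileGrad g b c x₀) o).comp fibreIncl))) ?_ ?_ ?_
  · exact (htr.continuousAt.comp h1).continuousWithinAt
  · intro o' ho'
    rw [profileTrHess, (h.hasFDerivAt_profileGrad hg hT ho').fderiv]
    rfl
  · rw [profileTrHess, (h.hasFDerivAt_profileGrad hg hT ho).fderiv]
    rfl

/-- Scaling of the Hessian of functions of the form `y ↦ k f(t y)`. -/
theorem UniquelySolvable.trHessY_eq_profileTrHess (h : UniquelySolvable g T b c r x₀)
    (hg : IsMetric g) (hT : 0 < T) {x y : E d} {k : ℝ}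
    (ho : (t • y₀, x, t • y) ∈ unitReached g b c x₀)
    (hφ : ∀ᶠ y' in 𝓝 y, φ t x y' = k * profile g b c x₀ (t • y₀, x, t • y')) :
    trHessY g φ t x y = k * t ^ 2 * profileTrHess g b c x₀ (t • y₀, x, t • y) := by
  have hsmul : ∀ y' : E d, HasFDerivAt (fun y : E d => t • y)
      (t • ContinuousLinearMap.id ℝ (E d)) y' := fun y' => (hasFDerivAt_id y').const_smul t
  have hmem : ∀ᶠ y' in 𝓝 y, (t • y₀, x, t • y') ∈ unitReached g b c x₀ := by
    have hc : Continuous fun y' : E d => (t • y₀, x, t • y') := by fun_prop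
    exact (hc.tendsto y).eventually ((h.isOpen_unitReached hg hT).mem_nhds ho)
  have hgrad : (fun y' => gradY φ t x y') =ᶠ[𝓝 y]
      fun y' => (k * t) • profileGrad g b c x₀ (t • y₀, x, t • y') := by
    filter_upwards [hφ.eventually_nhds, hmem] with y' h1 h2
    refine ext_inner_right ℝ fun v => ?_
    have h3 : HasFDerivAt (fun η => profile g b c x₀ (t • y₀, x, η))
        (fderiv ℝ (fun η => profile g b c x₀ (t • y₀, x, η)) (t • y')) (t • y') :=
      (HasFDerivAt.comp (t • y') (g := profile g b c x₀)
        ((h.contDiffAt_profile hg hT h2).differentiableAt (by simp)).hasFDerivAt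
        (hasFDerivAt_fibreIncl (t • y₀, x, t • y'))).differentiableAt.hasFDerivAt
    have h4 := ((HasFDerivAt.comp y' (f := fun y : E d => t • y) h3
      (hsmul y')).const_mul k).congr_of_eventuallyEq h1
    rw [gradY, inner_gradient, h4.fderiv, profileGrad, inner_smul_left, inner_gradient]
    simp
    ring
  have h5 := h.hasFDerivAt_profileGrad hg hT ho
  have h6 := ((HasFDerivAt.comp y (f := fun y : E d => t • y) h5
    (hsmul y)).const_smul (k * t)).congr_of_eventuallyEq hgrad
  rw [trHessY, h6.fderiv, profileTrHess, h5.fderiv]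
  rw [← smul_eq_mul (k * t ^ 2), ← map_smul]
  congr 1
  ext1 v
  simp [smul_smul]
  ring_nf

/-- The strict inequalities `ρ < r` and `β < b` leave a compact set of rescaled data inside the
reached set, on which the quotient is continuous. Including the starting point `η₀` in this set
makes `K` uniform in `y₀`; the halving anticipates the factor `h²/2`. -/
theorem UniquelySolvable.exists_profile_bound (h : UniquelySolvable g T b c r x₀)
    (hg : IsMetric g) (hT : 0 < T) {ρ β : ℝ} (hρ : ENNReal.ofReal ρ < r)
    (hβ : ENNReal.ofReal β < b) :
    ∃ K : ℝ, ∀ η₀ x η : E d, ‖η₀‖ ≤ β → ‖x - x₀‖ ≤ ρ → ‖η - η₀‖ ≤ ρ →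
      (η₀, x, η) ∈ unitReached g b c x₀ ∧
      |profileTrHess g b c x₀ (η₀, x, η)| / 2 ≤ K * profile g b c x₀ (η₀, x, η) := by
  set Q : Set (E d × E d × E d) := {o | ‖o.1‖ ≤ β ∧ ‖o.2.1 - x₀‖ ≤ ρ ∧ ‖o.2.2 - o.1‖ ≤ ρ}
  have hQclosed : IsClosed Q := by
    have h1 : IsClosed {o : E d × E d × E d | ‖o.1‖ ≤ β} :=
      isClosed_le (by fun_prop) continuous_const
    have h2 : IsClosed {o : E d × E d × E d | ‖o.2.1 - x₀‖ ≤ ρ} :=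
      isClosed_le (by fun_prop) continuous_const
    have h3 : IsClosed {o : E d × E d × E d | ‖o.2.2 - o.1‖ ≤ ρ} :=
      isClosed_le (by fun_prop) continuous_const
    exact h1.inter (h2.inter h3)
  have hQsub : Q ⊆ Metric.closedBall (0 : E d) β ×ˢ
      (Metric.closedBall x₀ ρ ×ˢ Metric.closedBall (0 : E d) (ρ + β)) := by
    rintro ⟨η₀, x, η⟩ ⟨h1, h2, h3⟩
    simp only at h1 h2 h3
    refine ⟨by simpa using h1, by simpa [dist_eq_norm] using h2, ?_⟩
    simp only [mem_closedBall_zero_iff]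
    calc ‖η‖ = ‖(η - η₀) + η₀‖ := by simp
      _ ≤ ρ + β := (norm_add_le _ _).trans (add_le_add h3 h1)
  have hQ : IsCompact Q := ((isCompact_closedBall _ _).prod
    ((isCompact_closedBall _ _).prod (isCompact_closedBall _ _))).of_isClosed_subset hQclosed hQsub
  have hQr : Q ⊆ unitReached g b c x₀ := by
    rintro ⟨η₀, x, η⟩ ⟨h1, h2, h3⟩
    exact h.polydisk_subset hg hT ((ENNReal.ofReal_le_ofReal h1).trans_lt hβ)
      ((ENNReal.ofReal_le_ofReal h2).trans_lt hρ) ((ENNReal.ofReal_le_ofReal h3).trans_lt hρ)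
  have hcont : ContinuousOn (fun o => profileTrHess g b c x₀ o / (2 * profile g b c x₀ o)) Q := by
    refine ((h.continuousOn_profileTrHess hg hT).mono hQr).div ?_ ?_
    · exact continuousOn_const.mul fun o ho =>
        (h.contDiffAt_profile hg hT (hQr ho)).continuousAt.continuousWithinAt
    · exact fun o ho => mul_ne_zero two_ne_zero (h.profile_pos hg hT (hQr ho)).ne'
  obtain ⟨K, hK⟩ := hQ.exists_bound_of_continuousOn hcont
  refine ⟨K, fun η₀ x η h1 h2 h3 => ?_⟩
  have hmem : (η₀, x, η) ∈ Q := ⟨h1, h2, h3⟩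
  refine ⟨hQr hmem, ?_⟩
  have hpos := h.profile_pos hg hT (hQr hmem)
  have h4 := hK _ hmem
  rw [Real.norm_eq_abs, abs_div, abs_of_pos (mul_pos two_pos hpos),
    div_le_iff₀ (mul_pos two_pos hpos)] at h4
  linarith

end Bound

end WKB

end

/-! ### The error identity and the uniform estimate -/

theorem mainTheorem2 {d : ℕ} (g : WKB.E d → WKB.E d →L[ℝ] WKB.E d) (hg : WKB.IsMetric g)
    (T : ℝ) (b c r : ℝ≥0∞) (x₀ : WKB.E d) (hsolv : WKB.UniquelySolvable g T b c r x₀)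
    (ρ β : ℝ) (hρ : ENNReal.ofReal ρ < r) (hβ : ENNReal.ofReal β < b) :
    ∃ K : ℝ, ∀ y₀ : WKB.E d, T * ‖y₀‖ ≤ β →
      ∀ (S φ : ℝ → WKB.E d → WKB.E d → ℝ) (κ : ℝ) (C : ℝ → ℝ),
        ContDiffOn ℝ 2 (fun z : ℝ × WKB.E d × WKB.E d => S z.1 z.2.1 z.2.2)
          (WKB.reached g T c x₀ y₀) →
        ContDiffOn ℝ 2 (fun z : ℝ × WKB.E d × WKB.E d => φ z.1 z.2.1 z.2.2)
          (WKB.reached g T c x₀ y₀) →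
        WKB.IsTwoPointFunction g T c x₀ y₀ S →
        WKB.HamiltonJacobi g (WKB.reached g T c x₀ y₀) S →
        WKB.Transport g (WKB.reached g T c x₀ y₀) S φ →
        Filter.Tendsto
          (fun z : ℝ × WKB.E d × WKB.E d => z.1 ^ (2 * d) * φ z.1 z.2.1 z.2.2)
          (𝓝[WKB.reached g T c x₀ y₀] (0, x₀, y₀)) (𝓝 κ) →
        (∀ h > 0, ∀ t x y, (t, x, y) ∈ WKB.reached g T c x₀ y₀ →
          WKB.parabolicOp g h (WKB.ansatz C S φ h) t x y =
            -(h ^ 2 / 2) * C h * (WKB.trHessY g φ t x y * Real.exp (-(S t x y) / h))) ∧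
        ∀ h > 0, ∀ t ∈ Set.Ioo 0 T, ∀ x y : WKB.E d, ‖x - x₀‖ ≤ ρ → t * ‖y - y₀‖ ≤ ρ →
          |WKB.parabolicOp g h (WKB.ansatz C S φ h) t x y| ≤
            K * h ^ 2 * t ^ 2 * |WKB.ansatz C S φ h t x y| := by
  rcases le_or_gt T 0 with hT | hT
  -- For `T ≤ 0` there are no admissible times, so any constant serves.
  · refine ⟨0, fun y₀ _ S φ κ C _ _ _ _ _ _ => ⟨fun h _ t x y hz => ?_, fun h _ t ht => ?_⟩⟩
    · exact absurd (hz.1.1.trans hz.1.2) (not_lt.2 hT)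
    · exact absurd (ht.1.trans ht.2) (not_lt.2 hT)
  obtain ⟨K, hK⟩ := hsolv.exists_profile_bound hg hT hρ hβ
  refine ⟨K, fun y₀ hy₀ S φ κ C hS hφ hS2 hHJ htr hκ => ?_⟩
  have hβt : ∀ t ∈ Set.Ioo 0 T, t * ‖y₀‖ ≤ β := fun t ht =>
    (mul_le_mul_of_nonneg_right ht.2.le (norm_nonneg _)).trans hy₀
  have hb : ∀ t ∈ Set.Ioo 0 T, ENNReal.ofReal (t * ‖y₀‖) < b := fun t ht =>
    (ENNReal.ofReal_le_ofReal (hβt t ht)).trans_lt hβ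
  have hopen := hsolv.isOpen_reached hg hb
  have hid : ∀ h > 0, ∀ t x y, (t, x, y) ∈ WKB.reached g T c x₀ y₀ →
      WKB.parabolicOp g h (WKB.ansatz C S φ h) t x y =
        -(h ^ 2 / 2) * C h * (WKB.trHessY g φ t x y * Real.exp (-(S t x y) / h)) :=
    fun h hh t x y hz => WKB.parabolicOp_ansatz hg hh (hS.contDiffAt (hopen.mem_nhds hz))
      (hφ.contDiffAt (hopen.mem_nhds hz)) (hHJ t x y hz) (htr t x y hz)
  refine ⟨hid, fun h hh t ht x y hx hy => ?_⟩
  obtain ⟨ho, hbound⟩ := hK (t • y₀) x (t • y)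
    (by rw [norm_smul, Real.norm_of_nonneg ht.1.le]; exact hβt t ht) hx
    (by rw [← smul_sub, norm_smul, Real.norm_of_nonneg ht.1.le]; exact hy)
  have hz : (t, x, y) ∈ WKB.reached g T c x₀ y₀ := (WKB.mem_reached_iff hg ht (hb t ht)).2 ho
  -- All dependence on the normalisation of `φ` sits in `k`, which appears as `|k|` on both sides of
  -- the estimate, so that `k = 0` needs no separate case.
  set k := κ * √|WKB.unitJac g x₀ 0| / t ^ (2 * d)
  have hφk : ∀ y', (t, x, y') ∈ WKB.reached g T c x₀ y₀ →
      φ t x y' = k * WKB.profile g b c x₀ (t • y₀, x, t • y') := fun y' hy' =>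
    hsolv.amplitude_eq_profile hg hb hS hφ hS2 htr hκ hy'
  -- The Hessian needs the formula on a neighbourhood of `y`, available because the reached set is
  -- open.
  have hnear : ∀ᶠ y' in 𝓝 y, φ t x y' = k * WKB.profile g b c x₀ (t • y₀, x, t • y') := by
    have hc : Continuous fun y' : WKB.E d => (t, x, y') := by fun_prop
    filter_upwards [(hc.tendsto y).eventually (hopen.mem_nhds hz)] with y' hy'
    exact hφk y' hy'
  have htrH := hsolv.trHessY_eq_profileTrHess hg hT ho hnear
  have hpos := hsolv.profile_pos hg hT ho
  rw [hid h hh t x y hz, htrH, WKB.ansatz, hφk y hz]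
  set p := WKB.profile g b c x₀ (t • y₀, x, t • y)
  set R := WKB.profileTrHess g b c x₀ (t • y₀, x, t • y)
  have hexp := Real.exp_pos (-(S t x y) / h)
  set e := Real.exp (-(S t x y) / h)
  have hl : |-(h ^ 2 / 2) * C h * (k * t ^ 2 * R * e)| =
      (h ^ 2 * t ^ 2 * |C h| * |k| * e) * (|R| / 2) := by
    simp only [abs_mul, abs_neg, abs_div, abs_pow, abs_of_pos hh, abs_of_pos ht.1,
      abs_of_pos hexp, abs_two]
    ring
  have hr : |C h * (k * p) * e| = |C h| * |k| * e * p := by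
    simp only [abs_mul, abs_of_pos hpos, abs_of_pos hexp]
    ring
  rw [hl, hr]
  calc (h ^ 2 * t ^ 2 * |C h| * |k| * e) * (|R| / 2)
      ≤ (h ^ 2 * t ^ 2 * |C h| * |k| * e) * (K * p) :=
        mul_le_mul_of_nonneg_left hbound (by positivity)
    _ = K * h ^ 2 * t ^ 2 * (|C h| * |k| * e * p) := by ring
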